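/- Let $\phi,\psi:\mathbb R\to\mathbb R$ be compactly supported father and mother wavelets, $\psi$ bounded, such that $\{\phi(\cdot-k)\}_{k\in\mathbb Z}\cup\{2^{j/2}\psi(2^j\cdot-k)\}_{j\ge 0,\,k\in\mathbb Z}$ is an orthonormal basis of $L^2(\mathbb R)$, and let $\psi_{j,k}(x)=\sum_{l\in\mathbb Z}2^{j/2}\psi(2^j(x-l)-k)$ be the periodized wavelets. Consider the regression model with random design $$Y_i=f(X_i)+z_i,\qquad i=1,\dots,n,$$ where $X_1,\dots,X_n$ are i.i.d. in $[0,1]$ with density $g$, and $z_1,\dots,z_n$ are i.i.d. $N(0,1)$ and independent of $(X_1,\dots,X_n)$. Assume that $|f|\le M'$ and $c\le g\le G$ almost everywhere on $[0,1]$, where $M'>0$ and $0<c\le G<\infty$. Set $$\beta_{j,k}=\int_0^1 f(x)\psi_{j,k}(x)\,dx,\qquad \hat\beta_{j,k}=n^{-1}\sum_{i=1}^n Y_i\,g(X_i)^{-1}\psi_{j,k}(X_i).$$ For $p\in[2,\infty)$ let $L=\lfloor(\log n)^{p/2}\rfloor$, $j_1=\lfloor (p/2)\log_2(\log n)\rfloor$,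 $j_2=\lfloor(1/2)\log_2(n/\log n)\rfloor$, $\mathcal A_j=\{1,\dots,\lceil 2^jL^{-1}\rceil\}$, and, for $K\in\mathcal A_j$, $\mathcal B_{j,K}=\{k\in\{0,\dots,2^j-1\}:(K-1)L\le k\le KL-1\}$. **Proposition.** Let $p\ge2$. There exist constants $\mu_1>0$ and $C>0$ and an integer $N$, depending only on $p,\phi,\psi,M',c,G$, such that for all $n\ge N$, all measurable $f$ and $g$ as above, and all integers $j$ with $j_1\le j\le j_2$: * for all $k\in\{0,\dots,2^j-1\}$, $|\hat\beta_{j,k}-\beta_{j,k}|^{2p}$ is integrable and $$\mathbb E\left(|\hat\beta_{j,k}-\beta_{j,k}|^{2p}\right)\le C n^{-p};$$ * for all $K\in\mathcal A_j$, $$\mathbb P\left(\Big[L^{-1}\sum_{k\in\mathcal B_{j,K}}|\hat\beta_{j,k}-\beta_{j,k}|^p\Big]^{1/p}\ge \mu_1 2^{-1}n^{-1/2}\right)\le 4n^{-p}.$$ -/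

import Mathlib

open MeasureTheory ProbabilityTheory

noncomputable section

namespace WaveletRegression

/-- The dilated and translated function `h_{j,k}(x) = 2^{j/2} h(2^j x - k)`. -/
def dilate (h : ℝ → ℝ) (j : ℕ) (k : ℤ) (x : ℝ) : ℝ :=
  (2 : ℝ) ^ ((j : ℝ) / 2) * h (2 ^ j * x - k)

/-- The inhomogeneous wavelet system on the line:
`φ_{0,k}`, `k ∈ ℤ`, together with `ψ_{j,k}`, `j ≥ 0`, `k ∈ ℤ`. -/
def waveletSystem (φ ψ : ℝ → ℝ) : ℤ ⊕ (ℕ × ℤ) → ℝ → ℝ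
  | Sum.inl k => dilate φ 0 k
  | Sum.inr jk => dilate ψ jk.1 jk.2

/-- `φ` and `ψ` are compactly supported father and mother wavelets (with `ψ` bounded) generating
an orthonormal wavelet basis of `L²(ℝ)` by dilation and translation. -/
structure IsWaveletPair (φ ψ : ℝ → ℝ) : Prop where
  measurable_father : Measurable φ
  measurable_mother : Measurable ψ
  hasCompactSupport_father : HasCompactSupport φ
  hasCompactSupport_mother : HasCompactSupport ψ
  bounded_mother : ∃ B : ℝ, ∀ x, |ψ x| ≤ B
  orthonormal_basis : ∃ b : HilbertBasis (ℤ ⊕ (ℕ × ℤ)) ℝ (Lp ℝ 2 (volume : Measure ℝ)),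
    ∀ i, (b i : ℝ → ℝ) =ᵐ[volume] waveletSystem φ ψ i

/-- The periodized wavelet `ψ^{per}_{j,k}(x) = ∑_{l ∈ ℤ} ψ_{j,k}(x - l)`. -/
def periodized (ψ : ℝ → ℝ) (j k : ℕ) (x : ℝ) : ℝ :=
  ∑' l : ℤ, dilate ψ j k (x - l)

/-- The wavelet coefficient `β_{j,k} = ∫₀¹ f(x) ψ^{per}_{j,k}(x) dx`. -/
def waveletCoeff (ψ f : ℝ → ℝ) (j k : ℕ) : ℝ :=
  ∫ x in Set.Icc (0 : ℝ) 1, f x * periodized ψ j k x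

/-- The empirical wavelet coefficient
`β̂_{j,k} = n⁻¹ ∑_{i} Y_i g(X_i)⁻¹ ψ^{per}_{j,k}(X_i)`, from the data `x_i`, `y_i`. -/
def empiricalCoeff (ψ g : ℝ → ℝ) {n : ℕ} (x y : Fin n → ℝ) (j k : ℕ) : ℝ :=
  (n : ℝ)⁻¹ * ∑ i, y i * (g (x i))⁻¹ * periodized ψ j k (x i)

/-- The block length `L = ⌊(log n)^{p/2}⌋`. -/
def blockLength (p : ℝ) (n : ℕ) : ℕ :=
  ⌊Real.log n ^ (p / 2)⌋₊

/-- The coarsest level `j₁ = ⌊(p/2) log₂ (log n)⌋` (nonnegative as soon as `n ≥ 3`). -/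
def coarsestLevel (p : ℝ) (n : ℕ) : ℕ :=
  ⌊p / 2 * Real.logb 2 (Real.log n)⌋₊

/-- The finest level `j₂ = ⌊(1/2) log₂ (n / log n)⌋` (nonnegative as soon as `n ≥ 3`). -/
def finestLevel (n : ℕ) : ℕ :=
  ⌊1 / 2 * Real.logb 2 (n / Real.log n)⌋₊

/-- The set `𝓐_j = {1, …, 2^j / L}` of block indices at level `j`. The upper end is rounded up, so
that the blocks always cover `{0, …, 2^j - 1}`: when `L` does not divide `2^j`, the last,
incomplete block is included. -/
def blockIndices (p : ℝ) (n j : ℕ) : Finset ℕ :=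
  Finset.Icc 1 ⌈(2 : ℝ) ^ j / (blockLength p n : ℝ)⌉₊

/-- The block `𝓑_{j,K} = {k ∈ {0, …, 2^j - 1} : (K - 1) L ≤ k ≤ K L - 1}`, for `K ≥ 1`. -/
def block (p : ℝ) (n j K : ℕ) : Finset ℕ :=
  (Finset.range (2 ^ j)).filter fun k =>
    (K - 1) * blockLength p n ≤ k ∧ k < K * blockLength p n

/-- `n` observations of the regression model with random design `Y_i = f(X_i) + z_i`: the `X_i`
are i.i.d. on `[0, 1]` with density `g`, the errors `z_i` are i.i.d. standard Gaussian, and the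
vector of the `z_i` is independent of the vector of the `X_i`. -/
structure IsRandomDesignSample {Ω : Type*} [MeasurableSpace Ω] (P : Measure Ω) (f g : ℝ → ℝ)
    {n : ℕ} (X Y z : Fin n → Ω → ℝ) : Prop where
  measurable_design : ∀ i, Measurable (X i)
  measurable_noise : ∀ i, Measurable (z i)
  law_design : ∀ i, P.map (X i) =
    (volume.restrict (Set.Icc (0 : ℝ) 1)).withDensity fun x => ENNReal.ofReal (g x)
  law_noise : ∀ i, P.map (z i) = gaussianReal 0 1
  indep_design : iIndepFun X P
  indep_noise : iIndepFun z P
  indep_design_noise : IndepFun (fun ω i => X i ω) (fun ω i => z i ω) P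
  regression : ∀ i ω, Y i ω = f (X i ω) + z i ω

end WaveletRegression

end

/-! Everything rests on one estimate: the normalised errors `W k = √n (β̂_{j,k} - β_{j,k})` of a
level satisfy `E exp(∑ t_k W_k) ≤ exp(C ∑ t_k²)` for all `t` in a cube of radius `τ n^{1/4}`. No
independence between the `W k` is needed.

To get it, put `u = (∑ t_k ψ_{j,k}) / (g √n)`. The exponent is a sum over the observations of
centred terms `f u` plus noise terms `z u`. Integrating the Gaussian noise produces `u² / 2`,
independence of the design leaves an `n`-th power, and a second-order expansion for small `u` bounds
each factor by `exp(const ∫ u²)`. A Schur-type bound controls `∫ (∑ t_k ψ_{j,k})²` by `∑ t_k²`,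
uniformly in `j`. Smallness of `u` is where `2^{j/2} ≤ n^{1/4}`, that is `j ≤ j₂`, enters.

The moment bound follows from `|w|^{2p} ≤ K (e^w + e^{-w})`. For the block bound, truncate at `M ≍
√(log n)`, with a union bound for the exceptional event. On `|w| ≤ M`, `ε |w|^p` with `ε ≍ M^{2-p}`
is at most a small multiple of `w²`, so `exp(ε |w|^p)` is dominated by a positive combination of
exponentials `exp(δ a w)`, `a` an integer. Products over `k` then reduce to the joint estimate, and
Markov's inequality gives the tail, since `ε L ≍ log n`. -/

namespace WaveletRegression

/-- The family `W` has a joint moment generating function dominated by that of a Gaussian vector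
with covariance `2 C • 1`, for all parameters in the cube of radius `T`. -/
def SubGaussianOn {Ω ι : Type*} [MeasurableSpace Ω] [Fintype ι] (P : Measure Ω) (W : ι → Ω → ℝ)
    (C T : ℝ) : Prop :=
  ∀ t : ι → ℝ, (∀ k, |t k| ≤ T) →
    ∫⁻ ω, ENNReal.ofReal (Real.exp (∑ k, t k * W k ω)) ∂P ≤
      ENNReal.ofReal (Real.exp (C * ∑ k, t k ^ 2))

/-! ### Moments and `ℓ^p` deviations of jointly sub-Gaussian families -/

section Abstract

variable {Ω ι : Type*} [MeasurableSpace Ω] [Fintype ι] {P : Measure Ω} {W : ι → Ω → ℝ} {C T : ℝ}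

theorem SubGaussianOn.lintegral_exp_mul_le (h : SubGaussianOn P W C T) (k : ι) {t : ℝ}
    (hT : 0 ≤ T) (ht : |t| ≤ T) :
    ∫⁻ ω, ENNReal.ofReal (Real.exp (t * W k ω)) ∂P ≤ ENNReal.ofReal (Real.exp (C * t ^ 2)) := by
  classical
  have := h (Pi.single k t) (fun l => by
    by_cases hl : l = k
    · subst hl; simpa using ht
    · simpa [hl] using hT)
  simpa [Pi.single_apply, ite_pow] using this

/-- Substitute for independence: expanding the product over all choice functions `ι → S` leaves
exponentials of linear forms with coefficients in the cube, and the Gaussian bounds of these factor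
back into a product. -/
theorem SubGaussianOn.lintegral_prod_sum_exp_le (h : SubGaussianOn P W C T)
    (hW : ∀ k, Measurable (W k)) {σ : Type*} (S : Finset σ) (b θ : σ → ℝ) (hb : ∀ a ∈ S, 0 ≤ b a)
    (hθ : ∀ a ∈ S, |θ a| ≤ T) :
    ∫⁻ ω, ENNReal.ofReal (∏ k, ∑ a ∈ S, b a * Real.exp (θ a * W k ω)) ∂P ≤
      ENNReal.ofReal ((∑ a ∈ S, b a * Real.exp (C * θ a ^ 2)) ^ Fintype.card ι) := by
  classical
  have hbx : ∀ x ∈ Fintype.piFinset (fun _ : ι => S), 0 ≤ ∏ k, b (x k) := fun x hx =>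
    Finset.prod_nonneg fun k _ => hb _ (Fintype.mem_piFinset.1 hx k)
  calc ∫⁻ ω, ENNReal.ofReal (∏ k, ∑ a ∈ S, b a * Real.exp (θ a * W k ω)) ∂P
      = ∫⁻ ω, ∑ x ∈ Fintype.piFinset (fun _ : ι => S), ENNReal.ofReal (∏ k, b (x k)) *
          ENNReal.ofReal (Real.exp (∑ k, θ (x k) * W k ω)) ∂P := by
        refine lintegral_congr fun ω => ?_
        rw [Finset.prod_univ_sum, ENNReal.ofReal_sum_of_nonneg]
        · refine Finset.sum_congr rfl fun x hx => ?_
          rw [← ENNReal.ofReal_mul (hbx x hx), Finset.prod_mul_distrib, Real.exp_sum]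
        · intro x hx
          exact Finset.prod_nonneg fun k _ =>
            mul_nonneg (hb _ (Fintype.mem_piFinset.1 hx k)) (Real.exp_nonneg _)
    _ = ∑ x ∈ Fintype.piFinset (fun _ : ι => S), ENNReal.ofReal (∏ k, b (x k)) *
          ∫⁻ ω, ENNReal.ofReal (Real.exp (∑ k, θ (x k) * W k ω)) ∂P := by
        rw [lintegral_finsetSum _ (fun x _ => by fun_prop)]
        exact Finset.sum_congr rfl fun x _ => lintegral_const_mul _ (by fun_prop)
    _ ≤ ∑ x ∈ Fintype.piFinset (fun _ : ι => S), ENNReal.ofReal (∏ k, b (x k)) *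
          ENNReal.ofReal (Real.exp (C * ∑ k, θ (x k) ^ 2)) := by
        gcongr with x hx
        exact h _ fun k => hθ _ (Fintype.mem_piFinset.1 hx k)
    _ = ENNReal.ofReal ((∑ a ∈ S, b a * Real.exp (C * θ a ^ 2)) ^ Fintype.card ι) := by
        rw [← Finset.card_univ, ← Finset.prod_const, Finset.prod_univ_sum,
          ENNReal.ofReal_sum_of_nonneg]
        · refine Finset.sum_congr rfl fun x hx => ?_
          rw [← ENNReal.ofReal_mul (hbx x hx), Finset.prod_mul_distrib, Finset.mul_sum,
            Real.exp_sum]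
        · intro x hx
          exact Finset.prod_nonneg fun k _ =>
            mul_nonneg (hb _ (Fintype.mem_piFinset.1 hx k)) (Real.exp_nonneg _)

/-- Discretised Gaussian majorant of `w ↦ exp (ε |w| ^ p)` on `|w| ≤ M`. -/
theorem exp_rpow_abs_le_sum {p M lam del w : ℝ} (hp : 2 ≤ p) (hM : 0 < M) (hlam : 0 < lam)
    (hdel : 0 < del) (hw : |w| ≤ M) :
    Real.exp (lam * M ^ (2 - p) * |w| ^ p) ≤
      1 + lam * M ^ (2 - p) * ∑ a ∈ Finset.Icc (-(⌊M⌋₊ : ℤ)) ⌊M⌋₊,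
        (|(a : ℝ)| + 1) ^ p * Real.exp (lam * (|(a : ℝ)| + 1) ^ 2 - del * (a : ℝ) ^ 2) *
          Real.exp (del * a * w) := by
  set r : ℕ := ⌊|w|⌋₊ with hr
  have hr1 : (r : ℝ) ≤ |w| := Nat.floor_le (abs_nonneg w)
  have hr2 : |w| ≤ r + 1 := (Nat.lt_floor_add_one _).le
  have hrM : r ≤ ⌊M⌋₊ := Nat.floor_le_floor hw
  set ε := lam * M ^ (2 - p) with hε
  have hε0 : 0 < ε := by positivity
  set x := ε * |w| ^ p with hx
  have hx0 : 0 ≤ x := by positivity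
  -- Keeping the factor `x` makes the excess over `1` proportional to `ε`, so that a product over
  -- `k` stays of size `exp(const * ε * card)`.
  have h1 : Real.exp x ≤ 1 + x * Real.exp x := by
    have := Real.add_one_le_exp (-x)
    have h2 : Real.exp x * Real.exp (-x) = 1 := by rw [← Real.exp_add]; simp
    nlinarith [Real.exp_pos x]
  have hxle : x ≤ ε * ((r : ℝ) + 1) ^ p := by
    rw [hx]; gcongr
  -- The bound `hxle` serves for the prefactor `x`; this quadratic one, which uses `|w| ≤ M`, serves
  -- for the exponent.
  have hxle2 : x ≤ lam * ((r : ℝ) + 1) ^ 2 := by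
    have e1 : |w| ^ p = |w| ^ (p - 2) * |w| ^ 2 := by
      rcases eq_or_lt_of_le (abs_nonneg w) with h0 | h0
      · rw [← h0, Real.zero_rpow (by linarith)]; simp
      · rw [← Real.rpow_natCast, ← Real.rpow_add h0]; norm_num
    have e2 : |w| ^ (p - 2) ≤ M ^ (p - 2) := by gcongr
    have e3 : M ^ (2 - p) * M ^ (p - 2) = 1 := by
      rw [← Real.rpow_add hM]; simp
    calc x = lam * (M ^ (2 - p) * |w| ^ (p - 2)) * |w| ^ 2 := by rw [hx, hε, e1]; ring
      _ ≤ lam * (M ^ (2 - p) * M ^ (p - 2)) * ((r : ℝ) + 1) ^ 2 := by gcongr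
      _ = _ := by rw [e3, mul_one]
  -- The grid point is `|w|` rounded down, with the sign of `w`; then `a w ≥ a²`, so this single
  -- term of the sum suffices.
  obtain ⟨a, ha, haw⟩ : ∃ a : ℤ, |(a : ℝ)| = r ∧ (a : ℝ) * w = r * |w| := by
    rcases le_total 0 w with h0 | h0
    · exact ⟨r, by simp, by simp [abs_of_nonneg h0]⟩
    · exact ⟨-r, by simp, by simp [abs_of_nonpos h0]⟩
  have hmem : a ∈ Finset.Icc (-(⌊M⌋₊ : ℤ)) ⌊M⌋₊ := by
    rw [Finset.mem_Icc, ← abs_le]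
    have : |a| = (r : ℤ) := by exact_mod_cast ha
    rw [this]; exact_mod_cast hrM
  have hterm := Finset.single_le_sum (s := Finset.Icc (-(⌊M⌋₊ : ℤ)) ⌊M⌋₊)
    (f := fun a : ℤ => (|(a : ℝ)| + 1) ^ p * Real.exp (lam * (|(a : ℝ)| + 1) ^ 2 -
      del * (a : ℝ) ^ 2) * Real.exp (del * a * w)) (fun a _ => by positivity) hmem
  have hexp : Real.exp x ≤ Real.exp (lam * (|(a : ℝ)| + 1) ^ 2 - del * (a : ℝ) ^ 2) *
      Real.exp (del * a * w) := by
    rw [← Real.exp_add, Real.exp_le_exp, mul_assoc, haw, ha, ← sq_abs (a : ℝ), ha]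
    have : del * (r : ℝ) ^ 2 ≤ del * (r * |w|) := by
      rw [pow_two]; gcongr
    linarith
  calc Real.exp x ≤ 1 + x * Real.exp x := h1
    _ ≤ 1 + ε * ((r : ℝ) + 1) ^ p * (Real.exp (lam * (|(a : ℝ)| + 1) ^ 2 - del * (a : ℝ) ^ 2) *
          Real.exp (del * a * w)) := by gcongr
    _ = 1 + ε * ((|(a : ℝ)| + 1) ^ p * Real.exp (lam * (|(a : ℝ)| + 1) ^ 2 - del * (a : ℝ) ^ 2) *
          Real.exp (del * a * w)) := by rw [ha]; ring
    _ ≤ _ := by gcongr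

/-- Uniformity over finite sets matters because the grid `|a| ≤ M` grows with `n` while `Q` must
not. -/
theorem exists_bound_sum_rpow_mul_exp (p : ℝ) {s : ℝ} (hs : 0 < s) :
    ∃ Q : ℝ, 0 < Q ∧ ∀ S : Finset ℤ,
      ∑ a ∈ S, (|(a : ℝ)| + 1) ^ p * Real.exp (s - s * (a : ℝ) ^ 2) ≤ Q := by
  set m := ⌈p⌉₊
  have hnat : Summable fun r : ℕ => ((r : ℝ) + 1) ^ p * Real.exp (s - s * (r : ℝ) ^ 2) := by
    have h1 := (summable_nat_add_iff 1).2 (Real.summable_pow_mul_exp_neg_nat_mul m hs)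
    refine Summable.of_nonneg_of_le (fun r => by positivity) (fun r => ?_)
      (h1.mul_left (Real.exp (2 * s)))
    have e1 : ((r : ℝ) + 1) ^ p ≤ ((r : ℝ) + 1) ^ m := by
      rw [← Real.rpow_natCast]
      exact Real.rpow_le_rpow_of_exponent_le (by simp) (Nat.le_ceil p)
    have e2 : Real.exp (s - s * (r : ℝ) ^ 2) ≤ Real.exp (2 * s) * Real.exp (-s * (r + 1)) := by
      rw [← Real.exp_add, Real.exp_le_exp]
      have : (r : ℝ) ≤ (r : ℝ) ^ 2 := by exact_mod_cast Nat.le_self_pow two_ne_zero r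
      nlinarith
    calc _ ≤ ((r : ℝ) + 1) ^ m * (Real.exp (2 * s) * Real.exp (-s * (r + 1))) := by gcongr
      _ = _ := by push_cast; ring
  have hint : Summable fun a : ℤ => (|(a : ℝ)| + 1) ^ p * Real.exp (s - s * (a : ℝ) ^ 2) :=
    Summable.of_nat_of_neg (by simpa using hnat) (by simpa using hnat)
  refine ⟨∑' a : ℤ, (|(a : ℝ)| + 1) ^ p * Real.exp (s - s * (a : ℝ) ^ 2) + 1, ?_, fun S => ?_⟩
  · have : 0 ≤ ∑' a : ℤ, (|(a : ℝ)| + 1) ^ p * Real.exp (s - s * (a : ℝ) ^ 2) :=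
      tsum_nonneg fun a => by positivity
    linarith
  · have := hint.sum_le_tsum S (fun a _ => by positivity)
    linarith

/-- Each factor is replaced by its grid majorant, needed only for `|W k| ≤ M` since the integrand
vanishes elsewhere; the largest parameter used is `M / (2C)`. -/
theorem SubGaussianOn.lintegral_prod_exp_rpow_le (h : SubGaussianOn P W C T)
    (hW : ∀ k, Measurable (W k)) {p M Q : ℝ} (hp : 2 ≤ p) (hM : 0 < M) (hC : 0 < C)
    (hT : M / (2 * C) ≤ T) (hQ : ∀ S : Finset ℤ, ∑ a ∈ S, (|(a : ℝ)| + 1) ^ p *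
      Real.exp (1 / (8 * C) - 1 / (8 * C) * (a : ℝ) ^ 2) ≤ Q) :
    ∫⁻ ω, ENNReal.ofReal (∏ k, if |W k ω| ≤ M then
        Real.exp (1 / (16 * C) * M ^ (2 - p) * |W k ω| ^ p) else 0) ∂P ≤
      ENNReal.ofReal (Real.exp (1 / (16 * C) * M ^ (2 - p) * Q * Fintype.card ι)) := by
  set lam := 1 / (16 * C) with hlam
  set del := 1 / (2 * C) with hdel
  have hlam0 : 0 < lam := by positivity
  have hdel0 : 0 < del := by positivity
  set ε := lam * M ^ (2 - p) with hε
  have hε0 : 0 < ε := by positivity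
  set q : ℤ → ℝ := fun a =>
    (|(a : ℝ)| + 1) ^ p * Real.exp (lam * (|(a : ℝ)| + 1) ^ 2 - del * (a : ℝ) ^ 2) with hq
  have hq0 : ∀ a, 0 ≤ q a := fun a => by positivity
  -- The constant `1` of the majorant is carried by the grid point `a = 0`.
  set b : ℤ → ℝ := fun a => (if a = 0 then 1 else 0) + ε * q a with hb
  set S := Finset.Icc (-(⌊M⌋₊ : ℤ)) ⌊M⌋₊ with hS
  have h0S : (0 : ℤ) ∈ S := by simp [hS]
  have hsum : ∀ e : ℤ → ℝ, e 0 = 1 → ∑ a ∈ S, b a * e a = 1 + ε * ∑ a ∈ S, q a * e a := by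
    intro e he
    simp only [hb, add_mul, Finset.sum_add_distrib, ite_mul, one_mul, zero_mul,
      Finset.sum_ite_eq', h0S, if_true, he, Finset.mul_sum, mul_assoc]
  have hb0 : ∀ a ∈ S, 0 ≤ b a := fun a _ => by
    have := hq0 a
    simp only [hb]; positivity
  have hθ : ∀ a ∈ S, |del * (a : ℝ)| ≤ T := by
    intro a ha
    rw [hS, Finset.mem_Icc, ← abs_le] at ha
    have h1 : |(a : ℝ)| ≤ M := by
      refine le_trans ?_ (Nat.floor_le hM.le)
      exact_mod_cast ha
    rw [abs_mul, abs_of_pos hdel0]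
    calc del * |(a : ℝ)| ≤ del * M := by gcongr
      _ = M / (2 * C) := by rw [hdel]; ring
      _ ≤ T := hT
  have key := h.lintegral_prod_sum_exp_le hW S b (fun a => del * a) hb0 hθ
  refine (lintegral_mono fun ω => ENNReal.ofReal_le_ofReal ?_).trans
    (key.trans (ENNReal.ofReal_le_ofReal ?_))
  · refine Finset.prod_le_prod (fun k _ => by split_ifs <;> positivity) fun k _ => ?_
    rw [hsum _ (by simp)]
    split_ifs with hk
    · exact exp_rpow_abs_le_sum hp hM hlam0 hdel0 hk
    · have : 0 ≤ ∑ a ∈ S, q a * Real.exp (del * a * W k ω) :=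
        Finset.sum_nonneg fun a _ => mul_nonneg (hq0 a) (Real.exp_nonneg _)
      positivity
  · rw [hsum _ (by simp)]
    have h1 : ∑ a ∈ S, q a * Real.exp (C * (del * (a : ℝ)) ^ 2) ≤ Q := by
      refine le_trans (Finset.sum_le_sum fun a _ => ?_) (hQ S)
      rw [hq, mul_assoc, ← Real.exp_add]
      refine mul_le_mul_of_nonneg_left (Real.exp_le_exp.2 ?_) (by positivity)
      -- The total exponent is `lam (|a|+1)² - 8 lam a² + 4 lam a²`, at most `2 lam - 2 lam a²`
      -- because `(|a|+1)² ≤ 2a² + 2`.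
      have e1 : C * (del * (a : ℝ)) ^ 2 = 4 * lam * (a : ℝ) ^ 2 := by
        rw [hdel, hlam]; field_simp; ring
      have e2 : del = 8 * lam := by rw [hdel, hlam]; field_simp; ring
      have e3 : 1 / (8 * C) = 2 * lam := by rw [hlam]; field_simp; ring
      rw [e1, e2, e3, ← sq_abs (a : ℝ)]
      nlinarith [mul_nonneg hlam0.le (sq_nonneg (|(a : ℝ)| - 1))]
    have h2 : 1 + ε * ∑ a ∈ S, q a * Real.exp (C * (del * (a : ℝ)) ^ 2) ≤ Real.exp (ε * Q) := by
      have := Real.add_one_le_exp (ε * Q)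
      nlinarith
    have h3 : 0 ≤ ∑ a ∈ S, q a * Real.exp (C * (del * (a : ℝ)) ^ 2) :=
      Finset.sum_nonneg fun a _ => mul_nonneg (hq0 a) (Real.exp_nonneg _)
    calc _ ≤ Real.exp (ε * Q) ^ Fintype.card ι := by gcongr
      _ = _ := by rw [← Real.exp_nat_mul]; congr 1; ring

/-- Chernoff bound at `t = ±M / (2C)`, the minimiser of `C t² - |t| M`. -/
theorem SubGaussianOn.measure_lt_abs_le (h : SubGaussianOn P W C T) (hW : ∀ k, Measurable (W k))
    {M : ℝ} (hM : 0 < M) (hC : 0 < C) (hT : M / (2 * C) ≤ T) (k : ι) :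
    P {ω | M < |W k ω|} ≤ ENNReal.ofReal (2 * Real.exp (-(M ^ 2 / (4 * C)))) := by
  have hd : 0 < M / (2 * C) := by positivity
  have hone : ∀ s : ℝ, |s| = M / (2 * C) →
      P {ω | M / (2 * C) * M ≤ s * W k ω} ≤ ENNReal.ofReal (Real.exp (-(M ^ 2 / (4 * C)))) := by
    intro s hs
    have h1 := h.lintegral_exp_mul_le k (hd.le.trans hT) (hs.le.trans hT)
    have h2 := mul_meas_ge_le_lintegral (μ := P)
      (f := fun ω => ENNReal.ofReal (Real.exp (s * W k ω)))
      (by have := hW k; fun_prop) (ENNReal.ofReal (Real.exp (M / (2 * C) * M)))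
    have h3 : {ω | M / (2 * C) * M ≤ s * W k ω} ⊆
        {ω | ENNReal.ofReal (Real.exp (M / (2 * C) * M)) ≤
          ENNReal.ofReal (Real.exp (s * W k ω))} := fun ω hω =>
      ENNReal.ofReal_le_ofReal (Real.exp_le_exp.2 hω)
    have h4 := (mul_le_mul_right (measure_mono (μ := P) h3)
      (ENNReal.ofReal (Real.exp (M / (2 * C) * M)))).trans (h2.trans h1)
    rw [← sq_abs, hs] at h4
    have e : Real.exp (C * (M / (2 * C)) ^ 2) = Real.exp (M / (2 * C) * M) *
        Real.exp (-(M ^ 2 / (4 * C))) := by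
      rw [← Real.exp_add]; congr 1; field_simp; ring
    rw [e, ENNReal.ofReal_mul (Real.exp_nonneg _)] at h4
    exact (ENNReal.mul_le_mul_iff_right (by simp [Real.exp_pos]) ENNReal.ofReal_ne_top).1 h4
  have hsub : {ω | M < |W k ω|} ⊆ {ω | M / (2 * C) * M ≤ M / (2 * C) * W k ω} ∪
      {ω | M / (2 * C) * M ≤ (-(M / (2 * C))) * W k ω} := by
    intro ω hω
    rcases lt_abs.1 (show M < |W k ω| from hω) with h' | h'
    · left; exact mul_le_mul_of_nonneg_left h'.le hd.le
    · right
      show M / (2 * C) * M ≤ (-(M / (2 * C))) * W k ω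
      nlinarith
  calc _ ≤ _ := measure_mono hsub
    _ ≤ _ := measure_union_le _ _
    _ ≤ ENNReal.ofReal (Real.exp (-(M ^ 2 / (4 * C)))) +
        ENNReal.ofReal (Real.exp (-(M ^ 2 / (4 * C)))) :=
      add_le_add (hone _ (abs_of_pos hd)) (hone _ (by rw [abs_neg, abs_of_pos hd]))
    _ = _ := by rw [← ENNReal.ofReal_add (Real.exp_nonneg _) (Real.exp_nonneg _), two_mul]

/-- Deviation inequality for the `ℓ^p` norm of a vector that is jointly sub-Gaussian on a cube. -/
theorem SubGaussianOn.measure_sum_rpow_ge_le (h : SubGaussianOn P W C T)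
    (hW : ∀ k, Measurable (W k)) {p M Q : ℝ} (hp : 2 ≤ p) (hM : 0 < M) (hC : 0 < C)
    (hT : M / (2 * C) ≤ T) (hQ : ∀ S : Finset ℤ, ∑ a ∈ S, (|(a : ℝ)| + 1) ^ p *
      Real.exp (1 / (8 * C) - 1 / (8 * C) * (a : ℝ) ^ 2) ≤ Q) (x : ℝ) :
    P {ω | x ≤ ∑ k, |W k ω| ^ p} ≤
      ENNReal.ofReal (Fintype.card ι * (2 * Real.exp (-(M ^ 2 / (4 * C)))) +
        Real.exp (1 / (16 * C) * M ^ (2 - p) * (Q * Fintype.card ι - x))) := by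
  set ε := 1 / (16 * C) * M ^ (2 - p) with hε
  have hε0 : 0 < ε := by positivity
  have hmeas : Measurable fun ω => ENNReal.ofReal (∏ k, if |W k ω| ≤ M then
      Real.exp (ε * |W k ω| ^ p) else 0) := by
    refine ENNReal.measurable_ofReal.comp (Finset.measurable_prod _ fun k _ => ?_)
    refine Measurable.ite ?_ ?_ measurable_const
    · exact measurableSet_le ((hW k).abs) measurable_const
    · have := hW k; fun_prop
  have hB : P {ω | x ≤ ∑ k, |W k ω| ^ p ∧ ∀ k, |W k ω| ≤ M} ≤
      ENNReal.ofReal (Real.exp (ε * (Q * Fintype.card ι - x))) := by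
    have h1 := h.lintegral_prod_exp_rpow_le hW hp hM hC hT hQ
    have h2 := mul_meas_ge_le_lintegral (μ := P) hmeas (ENNReal.ofReal (Real.exp (ε * x)))
    have h3 : {ω | x ≤ ∑ k, |W k ω| ^ p ∧ ∀ k, |W k ω| ≤ M} ⊆
        {ω | ENNReal.ofReal (Real.exp (ε * x)) ≤ ENNReal.ofReal (∏ k, if |W k ω| ≤ M then
          Real.exp (ε * |W k ω| ^ p) else 0)} := by
      rintro ω ⟨hx, hk⟩
      refine ENNReal.ofReal_le_ofReal ?_
      simp only [hk, if_true]
      rw [← Real.exp_sum, Real.exp_le_exp, ← Finset.mul_sum]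
      gcongr
    have h4 := (mul_le_mul_right (measure_mono (μ := P) h3)
      (ENNReal.ofReal (Real.exp (ε * x)))).trans (h2.trans h1)
    have e : Real.exp (ε * Q * Fintype.card ι) = Real.exp (ε * x) *
        Real.exp (ε * (Q * Fintype.card ι - x)) := by
      rw [← Real.exp_add]; congr 1; ring
    rw [e, ENNReal.ofReal_mul (Real.exp_nonneg _)] at h4
    exact (ENNReal.mul_le_mul_iff_right (by simp [Real.exp_pos]) ENNReal.ofReal_ne_top).1 h4
  have hsub : {ω | x ≤ ∑ k, |W k ω| ^ p} ⊆ (⋃ k, {ω | M < |W k ω|}) ∪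
      {ω | x ≤ ∑ k, |W k ω| ^ p ∧ ∀ k, |W k ω| ≤ M} := by
    intro ω hω
    by_cases hk : ∀ k, |W k ω| ≤ M
    · exact Or.inr ⟨hω, hk⟩
    · push Not at hk
      exact Or.inl (Set.mem_iUnion.2 hk)
  calc _ ≤ _ := measure_mono hsub
    _ ≤ _ := measure_union_le _ _
    _ ≤ (∑ _k : ι, ENNReal.ofReal (2 * Real.exp (-(M ^ 2 / (4 * C))))) +
        ENNReal.ofReal (Real.exp (ε * (Q * Fintype.card ι - x))) := by
      refine add_le_add ((measure_iUnion_fintype_le _ _).trans ?_) hB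
      exact Finset.sum_le_sum fun k _ => h.measure_lt_abs_le hW hM hC hT k
    _ = _ := by
      rw [Finset.sum_const, Finset.card_univ, nsmul_eq_mul,
        ENNReal.ofReal_add (by positivity) (by positivity),
        ENNReal.ofReal_mul (p := (Fintype.card ι : ℝ)) (by positivity), ENNReal.ofReal_natCast]

theorem exists_rpow_abs_le_exp (q : ℝ) (hq : 0 ≤ q) :
    ∃ K : ℝ, 0 < K ∧ ∀ w : ℝ, |w| ^ q ≤ K * (Real.exp (1 * w) + Real.exp (-1 * w)) := by
  set m := ⌈q⌉₊
  refine ⟨1 + m.factorial, by positivity, fun w => ?_⟩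
  have h1 : Real.exp |w| ≤ Real.exp (1 * w) + Real.exp (-1 * w) := by
    rcases abs_cases w with ⟨h, _⟩ | ⟨h, _⟩ <;> rw [h] <;> simp [Real.exp_nonneg]
  have h2 : |w| ^ q ≤ 1 + |w| ^ m := by
    rcases le_total |w| 1 with h | h
    · have := Real.rpow_le_one (abs_nonneg w) h hq
      have : 0 ≤ |w| ^ m := by positivity
      linarith
    · have : |w| ^ q ≤ |w| ^ (m : ℝ) := Real.rpow_le_rpow_of_exponent_le h (Nat.le_ceil q)
      rw [Real.rpow_natCast] at this
      linarith
  have h3 := Real.pow_div_factorial_le_exp |w| (abs_nonneg w) m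
  rw [div_le_iff₀ (by positivity)] at h3
  have h4 : 1 ≤ Real.exp |w| := Real.one_le_exp (abs_nonneg w)
  calc _ ≤ (1 + (m.factorial : ℝ)) * Real.exp |w| := by linarith
    _ ≤ _ := by gcongr

theorem SubGaussianOn.integrable_and_integral_rpow_le (h : SubGaussianOn P W C T)
    (hW : ∀ k, Measurable (W k)) (hT : 1 ≤ T) {q K : ℝ} (hK : 0 < K)
    (hKq : ∀ w : ℝ, |w| ^ q ≤ K * (Real.exp (1 * w) + Real.exp (-1 * w))) (k : ι) :
    Integrable (fun ω => |W k ω| ^ q) P ∧ ∫ ω, |W k ω| ^ q ∂P ≤ K * (2 * Real.exp C) := by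
  have hm := hW k
  have hle : ∫⁻ ω, ENNReal.ofReal (|W k ω| ^ q) ∂P ≤ ENNReal.ofReal (K * (2 * Real.exp C)) := by
    calc ∫⁻ ω, ENNReal.ofReal (|W k ω| ^ q) ∂P
        ≤ ∫⁻ ω, ENNReal.ofReal K * (ENNReal.ofReal (Real.exp (1 * W k ω)) +
            ENNReal.ofReal (Real.exp (-1 * W k ω))) ∂P := by
          refine lintegral_mono fun ω => ?_
          rw [← ENNReal.ofReal_add (Real.exp_nonneg _) (Real.exp_nonneg _),
            ← ENNReal.ofReal_mul hK.le]
          exact ENNReal.ofReal_le_ofReal (hKq _)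
      _ = ENNReal.ofReal K * (∫⁻ ω, ENNReal.ofReal (Real.exp (1 * W k ω)) ∂P +
            ∫⁻ ω, ENNReal.ofReal (Real.exp (-1 * W k ω)) ∂P) := by
          rw [lintegral_const_mul _ (by fun_prop), lintegral_add_left (by fun_prop)]
      _ ≤ ENNReal.ofReal K * (ENNReal.ofReal (Real.exp (C * 1 ^ 2)) +
            ENNReal.ofReal (Real.exp (C * (-1) ^ 2))) := by
          gcongr
          · exact h.lintegral_exp_mul_le k (by linarith) (by simpa using hT)
          · exact h.lintegral_exp_mul_le k (by linarith) (by simpa using hT)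
      _ = _ := by
          rw [← ENNReal.ofReal_add (Real.exp_nonneg _) (Real.exp_nonneg _),
            ← ENNReal.ofReal_mul hK.le]
          norm_num [two_mul]
  have hint : Integrable (fun ω => |W k ω| ^ q) P := by
    refine ⟨(hm.abs.pow_const q).aestronglyMeasurable, ?_⟩
    rw [hasFiniteIntegral_iff_ofReal (Filter.Eventually.of_forall fun ω => by positivity)]
    exact hle.trans_lt ENNReal.ofReal_lt_top
  refine ⟨hint, ?_⟩
  rw [← ofReal_integral_eq_lintegral_ofReal hint
    (Filter.Eventually.of_forall fun ω => by positivity)] at hle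
  exact (ENNReal.ofReal_le_ofReal_iff (by positivity)).1 hle

end Abstract

/-! ### Exponential moments of the regression errors -/

theorem lintegral_exp_mul_gaussianReal (a b : ℝ) :
    ∫⁻ z, ENNReal.ofReal (Real.exp (a + z * b)) ∂(gaussianReal 0 1) =
      ENNReal.ofReal (Real.exp (a + b ^ 2 / 2)) := by
  have h := congrFun (mgf_id_gaussianReal (μ := 0) (v := 1)) b
  simp only [mgf, id, zero_mul, zero_add, NNReal.coe_one, one_mul] at h
  simp_rw [Real.exp_add, ENNReal.ofReal_mul (Real.exp_nonneg a), mul_comm _ b]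
  rw [lintegral_const_mul _ (by fun_prop), ← ofReal_integral_eq_lintegral_ofReal
    (integrable_exp_mul_gaussianReal b) (Filter.Eventually.of_forall fun z => Real.exp_nonneg _), h]

/-- With the design frozen, the Gaussian noise integrates to `exp(b² / 2)`; what remains is a
product of independent, identically distributed functions of the `X i`. -/
theorem lintegral_exp_sum_design {Ω : Type*} [MeasurableSpace Ω] {P : Measure Ω}
    [IsProbabilityMeasure P] {n : ℕ} {X z : Fin n → Ω → ℝ} {ν : Measure ℝ}
    (hX : ∀ i, Measurable (X i)) (hz : ∀ i, Measurable (z i)) (hXν : ∀ i, P.map (X i) = ν)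
    (hzγ : ∀ i, P.map (z i) = gaussianReal 0 1) (hXi : iIndepFun X P) (hzi : iIndepFun z P)
    (hXz : IndepFun (fun ω i => X i ω) (fun ω i => z i ω) P) {a b : ℝ → ℝ}
    (ha : Measurable a) (hb : Measurable b) :
    ∫⁻ ω, ENNReal.ofReal (Real.exp (∑ i, (a (X i ω) + z i ω * b (X i ω)))) ∂P =
      (∫⁻ x, ENNReal.ofReal (Real.exp (a x + b x ^ 2 / 2)) ∂ν) ^ n := by
  have hXv : Measurable fun ω i => X i ω := measurable_pi_lambda _ hX
  have hzv : Measurable fun ω i => z i ω := measurable_pi_lambda _ hz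
  have hprob : IsProbabilityMeasure (P.map fun ω i => z i ω) :=
    Measure.isProbabilityMeasure_map hzv.aemeasurable
  set F : (Fin n → ℝ) × (Fin n → ℝ) → ENNReal := fun q =>
    ∏ i, ENNReal.ofReal (Real.exp (a (q.1 i) + q.2 i * b (q.1 i))) with hF
  have hFm : Measurable F := by fun_prop
  calc ∫⁻ ω, ENNReal.ofReal (Real.exp (∑ i, (a (X i ω) + z i ω * b (X i ω)))) ∂P
      = ∫⁻ ω, F (fun i => X i ω, fun i => z i ω) ∂P := by
        refine lintegral_congr fun ω => ?_
        rw [Real.exp_sum, ENNReal.ofReal_prod_of_nonneg fun i _ => Real.exp_nonneg _]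
    _ = ∫⁻ q, F q ∂(P.map fun ω => (fun i => X i ω, fun i => z i ω)) :=
        (lintegral_map hFm (hXv.prodMk hzv)).symm
    _ = ∫⁻ x, ∫⁻ y, F (x, y) ∂(P.map fun ω i => z i ω) ∂(P.map fun ω i => X i ω) := by
        rw [(indepFun_iff_map_prod_eq_prod_map_map hXv.aemeasurable hzv.aemeasurable).1 hXz,
          lintegral_prod _ hFm.aemeasurable]
    _ = ∫⁻ x, ∏ i, ENNReal.ofReal (Real.exp (a (x i) + b (x i) ^ 2 / 2))
          ∂(P.map fun ω i => X i ω) := by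
        refine lintegral_congr fun x => ?_
        rw [lintegral_map (by fun_prop) hzv]
        have h1 := lintegral_prod_eq_prod_lintegral_of_indepFun Finset.univ
          (fun i ω => ENNReal.ofReal (Real.exp (a (x i) + z i ω * b (x i))))
          (hzi.comp (fun i t => ENNReal.ofReal (Real.exp (a (x i) + t * b (x i))))
            fun i => by fun_prop) (fun i => by have := hz i; fun_prop)
        refine h1.trans (Finset.prod_congr rfl fun i _ => ?_)
        rw [← lintegral_exp_mul_gaussianReal, ← hzγ i, lintegral_map (by fun_prop) (hz i)]
    _ = ∫⁻ ω, ∏ i, ENNReal.ofReal (Real.exp (a (X i ω) + b (X i ω) ^ 2 / 2)) ∂P :=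
        lintegral_map (by fun_prop) hXv
    _ = ∏ i, ∫⁻ ω, ENNReal.ofReal (Real.exp (a (X i ω) + b (X i ω) ^ 2 / 2)) ∂P :=
        lintegral_prod_eq_prod_lintegral_of_indepFun Finset.univ
          (fun i ω => ENNReal.ofReal (Real.exp (a (X i ω) + b (X i ω) ^ 2 / 2)))
          (hXi.comp (fun i t => ENNReal.ofReal (Real.exp (a t + b t ^ 2 / 2)))
            fun i => by fun_prop) (fun i => by have := hX i; fun_prop)
    _ = ∏ _i : Fin n, ∫⁻ x, ENNReal.ofReal (Real.exp (a x + b x ^ 2 / 2)) ∂ν := by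
        refine Finset.prod_congr rfl fun i _ => ?_
        rw [← hXν i, lintegral_map (by fun_prop) (hX i)]
    _ = _ := by simp

/-- Use `exp U ≤ 1 + U + U²` for `|U| ≤ 1`: centring kills the linear term in `f u`, and its
variance is at most `M² ∫ u²`. -/
theorem lintegral_exp_centered_le {ν : Measure ℝ} [IsProbabilityMeasure ν] {f u : ℝ → ℝ}
    {M v : ℝ} (hM : 0 ≤ M) (hf : Measurable f) (hu : Measurable u) (hfM : ∀ᵐ x ∂ν, |f x| ≤ M)
    (huM : ∀ᵐ x ∂ν, |u x| ≤ 1 / (2 * (M + 1))) (hv : ∫ x, u x ^ 2 ∂ν ≤ v) :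
    ∫⁻ x, ENNReal.ofReal (Real.exp (f x * u x - ∫ y, f y * u y ∂ν + u x ^ 2 / 2)) ∂ν ≤
      ENNReal.ofReal (Real.exp ((1 + 2 * M ^ 2) * v)) := by
  set κ := 1 / (2 * (M + 1)) with hκ
  have hκ0 : 0 < κ := by positivity
  set m := ∫ y, f y * u y ∂ν with hm
  have hfu : ∀ᵐ x ∂ν, |f x * u x| ≤ M * κ := by
    filter_upwards [hfM, huM] with x h1 h2
    rw [abs_mul]; gcongr
  have hbdd : ∀ {h : ℝ → ℝ} (K : ℝ), Measurable h → (∀ᵐ x ∂ν, |h x| ≤ K) → Integrable h ν :=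
    fun K hh hK => Integrable.of_bound hh.aestronglyMeasurable K hK
  have hmM : |m| ≤ M * κ := by
    have := norm_integral_le_of_norm_le_const (μ := ν) (f := fun y => f y * u y) hfu
    simpa using this
  have i1 : Integrable (fun x => f x * u x) ν := hbdd _ (by fun_prop) hfu
  have i2 : Integrable (fun x => u x ^ 2) ν := hbdd (κ ^ 2) (by fun_prop) (by
    filter_upwards [huM] with x h2
    rw [abs_pow]; gcongr)
  have i3 : Integrable (fun x => (f x * u x) ^ 2) ν := hbdd ((M * κ) ^ 2) (by fun_prop) (by
    filter_upwards [hfu] with x h2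
    rw [abs_pow]; gcongr)
  -- The threshold `κ` is chosen so that `2 M κ + κ² / 2 ≤ 1`, which keeps the exponent in the range
  -- of the expansion.
  have hMκ : M * κ ≤ 1 / 2 - κ / 2 ∧ κ ≤ 1 / 2 := by
    have : (M + 1) * κ = 1 / 2 := by rw [hκ]; field_simp
    constructor <;> nlinarith
  have hU : ∀ᵐ x ∂ν, |f x * u x - m + u x ^ 2 / 2| ≤ 1 ∧
      Real.exp (f x * u x - m + u x ^ 2 / 2) ≤
        1 + (f x * u x - m) + u x ^ 2 + 2 * (f x * u x - m) ^ 2 := by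
    filter_upwards [hfu, huM] with x h1 h2
    have h3 : u x ^ 2 ≤ κ ^ 2 := by rw [← sq_abs]; gcongr
    have h4 : |f x * u x - m + u x ^ 2 / 2| ≤ 1 := by
      rw [abs_le] at h1 hmM ⊢
      constructor <;> nlinarith [sq_nonneg (u x)]
    refine ⟨h4, ?_⟩
    have h5 := (abs_le.1 (Real.abs_exp_sub_one_sub_id_le h4)).2
    have h6 : u x ^ 2 ≤ 1 := by nlinarith
    nlinarith [sq_nonneg (f x * u x - m - u x ^ 2 / 2), sq_nonneg (u x)]
  have i4 : Integrable (fun x => Real.exp (f x * u x - m + u x ^ 2 / 2)) ν :=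
    hbdd (Real.exp 1) (by fun_prop) (by
      filter_upwards [hU] with x hx
      rw [abs_of_pos (Real.exp_pos _)]
      exact Real.exp_le_exp.2 ((le_abs_self _).trans hx.1))
  rw [← ofReal_integral_eq_lintegral_ofReal i4
    (Filter.Eventually.of_forall fun x => Real.exp_nonneg _)]
  refine ENNReal.ofReal_le_ofReal ?_
  have hsq : ∫ x, (f x * u x) ^ 2 ∂ν ≤ M ^ 2 * ∫ x, u x ^ 2 ∂ν := by
    rw [← integral_const_mul]
    refine integral_mono_ae i3 (i2.const_mul _) ?_
    filter_upwards [hfM] with x h1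
    show (f x * u x) ^ 2 ≤ M ^ 2 * u x ^ 2
    rw [mul_pow, ← sq_abs (f x)]
    gcongr
  have i5 : Integrable (fun x => (f x * u x) ^ 2 - (2 * m) * (f x * u x)) ν :=
    i3.sub (i1.const_mul (2 * m))
  have hvar : ∫ x, (f x * u x - m) ^ 2 ∂ν = ∫ x, (f x * u x) ^ 2 ∂ν - m ^ 2 := by
    have : ∀ x, (f x * u x - m) ^ 2 = (f x * u x) ^ 2 - (2 * m) * (f x * u x) + m ^ 2 := by
      intro x; ring
    simp_rw [this]
    rw [integral_add i5 (integrable_const _), integral_sub i3 (i1.const_mul _),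
      integral_const_mul, ← hm]
    simp
    ring
  have i6 : Integrable (fun x => (f x * u x - m) ^ 2) ν := by
    have : ∀ x, (f x * u x - m) ^ 2 = (f x * u x) ^ 2 - (2 * m) * (f x * u x) + m ^ 2 := by
      intro x; ring
    simp_rw [this]
    exact i5.add (integrable_const _)
  have i0 : Integrable (fun x => f x * u x - m) ν := i1.sub (integrable_const _)
  have i7 : Integrable (fun x => 1 + (f x * u x - m)) ν := (integrable_const _).add i0
  have i8 : Integrable (fun x => 1 + (f x * u x - m) + u x ^ 2) ν := i7.add i2
  calc ∫ x, Real.exp (f x * u x - m + u x ^ 2 / 2) ∂ν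
      ≤ ∫ x, (1 + (f x * u x - m) + u x ^ 2 + 2 * (f x * u x - m) ^ 2) ∂ν :=
        integral_mono_ae i4 (i8.add (i6.const_mul 2)) (hU.mono fun x hx => hx.2)
    _ = 1 + ∫ x, u x ^ 2 ∂ν + 2 * (∫ x, (f x * u x) ^ 2 ∂ν - m ^ 2) := by
        rw [integral_add i8 (i6.const_mul 2), integral_add i7 i2,
          integral_add (integrable_const _) i0,
          integral_sub i1 (integrable_const _), integral_const_mul, hvar, ← hm]
        simp
    _ ≤ (1 + 2 * M ^ 2) * v + 1 := by nlinarith [sq_nonneg m, sq_nonneg M]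
    _ ≤ _ := Real.add_one_le_exp _

/-- The normalised errors of the empirical coefficients with respect to a finite family of
bounded functions are jointly sub-Gaussian on a cube. -/
theorem IsRandomDesignSample.subGaussianOn {Ω ι : Type*} [MeasurableSpace Ω] [Fintype ι]
    {P : Measure Ω} [IsProbabilityMeasure P] {f g : ℝ → ℝ} {n : ℕ} {X Y z : Fin n → Ω → ℝ}
    (hs : IsRandomDesignSample P f g X Y z) (hn : 0 < n) {M c T R E : ℝ} (hM : 0 ≤ M) (hc : 0 < c)
    (hf : Measurable f) (hfM : ∀ᵐ x ∂(volume.restrict (Set.Icc (0 : ℝ) 1)), |f x| ≤ M)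
    (hg : Measurable g) (hgc : ∀ᵐ x ∂(volume.restrict (Set.Icc (0 : ℝ) 1)), c ≤ g x)
    {h : ι → ℝ → ℝ} (hh : ∀ k, Measurable (h k))
    (hR : ∀ x ∈ Set.Icc (0 : ℝ) 1, ∑ k, |h k x| ≤ R)
    (hE : ∀ t : ι → ℝ, ∫ x in Set.Icc (0 : ℝ) 1, (∑ k, t k * h k x) ^ 2 ≤ E * ∑ k, t k ^ 2)
    (hT : 0 ≤ T) (hTR : T * R ≤ c * √n / (2 * (M + 1))) :
    SubGaussianOn P (fun k ω => √n * ((n : ℝ)⁻¹ * ∑ i, Y i ω * (g (X i ω))⁻¹ * h k (X i ω) -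
      ∫ x in Set.Icc (0 : ℝ) 1, f x * h k x)) ((1 + 2 * M ^ 2) * (E / c)) T := by
  intro t ht
  have hn0 : (0 : ℝ) < n := by exact_mod_cast hn
  have hsn : 0 < √(n : ℝ) := Real.sqrt_pos.2 hn0
  have hss : √(n : ℝ) * √(n : ℝ) = n := Real.mul_self_sqrt hn0.le
  set lam := volume.restrict (Set.Icc (0 : ℝ) 1) with hlam
  set ν := lam.withDensity fun x => ENNReal.ofReal (g x) with hν
  have hprob : IsProbabilityMeasure ν := by
    rw [hν, ← hs.law_design ⟨0, hn⟩]
    exact Measure.isProbabilityMeasure_map (hs.measurable_design _).aemeasurable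
  have hac : ν ≪ lam := withDensity_absolutelyContinuous _ _
  have hint : ∀ F : ℝ → ℝ, ∫ x, F x ∂ν = ∫ x, g x * F x ∂lam := by
    intro F
    rw [hν, integral_withDensity_eq_integral_toReal_smul (by fun_prop)
      (Filter.Eventually.of_forall fun x => ENNReal.ofReal_lt_top)]
    refine integral_congr_ae ?_
    filter_upwards [hgc] with x hx
    rw [ENNReal.toReal_ofReal (hc.le.trans hx), smul_eq_mul]
  set S : ℝ → ℝ := fun x => ∑ k, t k * h k x with hS
  have hSm : Measurable S := by fun_prop
  set u : ℝ → ℝ := fun x => (g x)⁻¹ * S x / √n with hu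
  have hum : Measurable u := by fun_prop
  have hSR : ∀ᵐ x ∂lam, |S x| ≤ T * R := by
    rw [hlam]
    filter_upwards [ae_restrict_mem measurableSet_Icc] with x hx
    calc |S x| ≤ ∑ k, |t k * h k x| := Finset.abs_sum_le_sum_abs _ _
      _ ≤ ∑ k, T * |h k x| := Finset.sum_le_sum fun k _ => by
          rw [abs_mul]; exact mul_le_mul_of_nonneg_right (ht k) (abs_nonneg _)
      _ ≤ T * R := by rw [← Finset.mul_sum]; exact mul_le_mul_of_nonneg_left (hR x hx) hT
  have huM : ∀ᵐ x ∂ν, |u x| ≤ 1 / (2 * (M + 1)) := by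
    refine hac.ae_le ?_
    filter_upwards [hSR, hgc] with x h1 h2
    have h3 : 0 < g x := hc.trans_le h2
    rw [hu, abs_div, abs_mul, abs_inv, abs_of_pos h3, abs_of_pos hsn, div_le_iff₀ hsn,
      inv_mul_le_iff₀ h3]
    calc |S x| ≤ c * √n / (2 * (M + 1)) := h1.trans hTR
      _ ≤ g x * √n / (2 * (M + 1)) := by gcongr
      _ = _ := by ring
  have hSint : Integrable (fun x => S x ^ 2) lam :=
    Integrable.of_bound (by fun_prop) ((T * R) ^ 2) (by
      filter_upwards [hSR] with x hx
      rw [Real.norm_eq_abs, abs_pow]; gcongr)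
  -- The weight `g⁻²` against the density `g` leaves `g⁻¹ ≤ c⁻¹`. The factor `1 / n` is what the
  -- `n`-th power absorbs at the end.
  have hu2 : ∫ x, u x ^ 2 ∂ν ≤ E / c / n * ∑ k, t k ^ 2 := by
    rw [hint]
    calc ∫ x, g x * u x ^ 2 ∂lam ≤ ∫ x, (c * n)⁻¹ * S x ^ 2 ∂lam := by
          refine integral_mono_of_nonneg ?_ (hSint.const_mul _) ?_
          · filter_upwards [hgc] with x hx
            have : 0 < g x := hc.trans_le hx
            show 0 ≤ g x * u x ^ 2
            positivity
          · filter_upwards [hgc] with x hx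
            have h3 : 0 < g x := hc.trans_le hx
            have : g x * u x ^ 2 = (g x * n)⁻¹ * S x ^ 2 := by
              rw [hu, show (g x * (n : ℝ))⁻¹ = (g x * (√n * √n))⁻¹ by rw [hss]]; field_simp
            show g x * u x ^ 2 ≤ _
            rw [this]; gcongr
      _ = (c * n)⁻¹ * ∫ x, S x ^ 2 ∂lam := integral_const_mul _ _
      _ ≤ (c * n)⁻¹ * (E * ∑ k, t k ^ 2) := by gcongr; exact hE t
      _ = _ := by field_simp
  set m := ∫ y, f y * u y ∂ν with hm
  have hfh : ∀ k, Integrable (fun x => f x * h k x) lam := fun k =>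
    Integrable.of_bound (by have := hh k; fun_prop) (M * R) (by
      filter_upwards [hfM, ae_restrict_mem measurableSet_Icc] with x h1 h2
      rw [Real.norm_eq_abs, abs_mul]
      have : |h k x| ≤ R := (Finset.single_le_sum (f := fun k => |h k x|)
        (fun k _ => abs_nonneg _) (Finset.mem_univ k)).trans (hR x h2)
      gcongr)
  -- Unbiasedness: the weight `g⁻¹` cancels the design density.
  have hmβ : √n * m = ∑ k, t k * ∫ x, f x * h k x ∂lam := by
    rw [hm, hint, ← integral_const_mul]
    have : ∀ᵐ x ∂lam, √n * (g x * (f x * u x)) = ∑ k, t k * (f x * h k x) := by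
      filter_upwards [hgc] with x hx
      have h3 : 0 < g x := hc.trans_le hx
      have : √n * (g x * (f x * u x)) = f x * S x := by
        rw [hu]; field_simp
      rw [this, hS, Finset.mul_sum]
      exact Finset.sum_congr rfl fun k _ => by ring
    rw [integral_congr_ae this, integral_finsetSum _ fun k _ => (hfh k).const_mul _]
    simp_rw [integral_const_mul]
  have hlin : ∀ ω, ∑ k, t k * (√n * ((n : ℝ)⁻¹ * ∑ i, Y i ω * (g (X i ω))⁻¹ * h k (X i ω) -
      ∫ x, f x * h k x ∂lam)) =
      ∑ i, ((f (X i ω) * u (X i ω) - m) + z i ω * u (X i ω)) := by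
    intro ω
    have e1 : ∑ k, t k * (√n * ((n : ℝ)⁻¹ * ∑ i, Y i ω * (g (X i ω))⁻¹ * h k (X i ω) -
        ∫ x, f x * h k x ∂lam)) =
        ∑ k, t k * ((√n)⁻¹ * ∑ i, Y i ω * (g (X i ω))⁻¹ * h k (X i ω)) -
          √n * ∑ k, t k * ∫ x, f x * h k x ∂lam := by
      rw [Finset.mul_sum, ← Finset.sum_sub_distrib]
      refine Finset.sum_congr rfl fun k _ => ?_
      have : √(n : ℝ) * (n : ℝ)⁻¹ = (√(n : ℝ))⁻¹ := by
        nth_rewrite 2 [← hss]; field_simp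
      rw [← this]; ring
    have e2 : ∑ k, t k * ((√n)⁻¹ * ∑ i, Y i ω * (g (X i ω))⁻¹ * h k (X i ω)) =
        ∑ i, Y i ω * u (X i ω) := by
      simp_rw [Finset.mul_sum]
      rw [Finset.sum_comm]
      refine Finset.sum_congr rfl fun i _ => ?_
      rw [hu, hS]
      simp only [Finset.mul_sum, Finset.sum_div]
      exact Finset.sum_congr rfl fun k _ => by rw [div_eq_mul_inv]; ring
    have e3 : √(n : ℝ) * (√n * m) = ∑ _i : Fin n, m := by
      rw [← mul_assoc, hss]; simp
    rw [e1, e2, ← hmβ, e3, ← Finset.sum_sub_distrib]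
    refine Finset.sum_congr rfl fun i _ => ?_
    rw [hs.regression]; ring
  simp_rw [hlin]
  rw [lintegral_exp_sum_design hs.measurable_design hs.measurable_noise hs.law_design hs.law_noise
    hs.indep_design hs.indep_noise hs.indep_design_noise (a := fun x => f x * u x - m)
    (by fun_prop) hum]
  refine (pow_le_pow_left₀ zero_le (lintegral_exp_centered_le hM hf hum (hac.ae_le hfM) huM
    hu2) n).trans (le_of_eq ?_)
  rw [← ENNReal.ofReal_pow (Real.exp_nonneg _), ← Real.exp_nat_mul]
  congr 2
  field_simp

/-! ### Periodized wavelets: locality, size, and the quadratic form bound -/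

section Wavelet

variable {ψ : ℝ → ℝ} {S : ℕ} {B : ℝ}

/-- For `x ∈ [0,1]`, `0 ≤ k < 2^j` and `|l| ≥ S + 2`, the argument of `ψ` exceeds `S` in absolute
value, so the window does not depend on `j` or `k`. -/
theorem periodized_eq_sum (hS : ∀ y, (S : ℝ) < |y| → ψ y = 0) {j k : ℕ} (hk : k < 2 ^ j) {x : ℝ}
    (hx : x ∈ Set.Icc (0 : ℝ) 1) :
    periodized ψ j k x = ∑ l ∈ Finset.Icc (-((S : ℤ) + 1)) ((S : ℤ) + 1), dilate ψ j k (x - l) := by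
  refine tsum_eq_sum fun l hl => ?_
  have hl' : (S : ℝ) + 2 ≤ |(l : ℝ)| := by
    rw [Finset.mem_Icc, ← abs_le, not_le] at hl
    have : (S : ℤ) + 2 ≤ |l| := by omega
    exact_mod_cast this
  have h2 : (1 : ℝ) ≤ 2 ^ j := one_le_pow₀ one_le_two
  have hk' : (k : ℝ) < 2 ^ j := by exact_mod_cast hk
  have hk0 : (0 : ℝ) ≤ k := by positivity
  have : (S : ℝ) < |2 ^ j * (x - l) - (k : ℤ)| := by
    push_cast
    obtain ⟨hx0, hx1⟩ := hx
    have hS0 : (0 : ℝ) ≤ S := by positivity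
    rcases le_abs'.1 hl' with h | h
    · refine lt_of_lt_of_le ?_ (le_abs_self _)
      nlinarith
    · refine lt_of_lt_of_le ?_ (neg_le_abs _)
      nlinarith
  rw [dilate, hS _ this, mul_zero]

theorem measurable_dilate (hψ : Measurable ψ) (j : ℕ) (k : ℤ) : Measurable (dilate ψ j k) := by
  unfold dilate
  fun_prop

/-- Off `[0,1]` no fixed window works, but at each point only finitely many terms are nonzero, so
the function is a pointwise limit of its partial sums. -/
theorem measurable_periodized (hψ : Measurable ψ) (hS : ∀ y, (S : ℝ) < |y| → ψ y = 0) (j k : ℕ) :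
    Measurable (periodized ψ j k) := by
  have hd := measurable_dilate hψ j k
  refine measurable_of_tendsto_metrizable'
    (f := fun s : Finset ℤ => fun x : ℝ => ∑ l ∈ s, dilate ψ j k (x - l)) Filter.atTop
    (fun s => by fun_prop) ?_
  rw [tendsto_pi_nhds]
  intro x
  suffices hfin : Summable fun l : ℤ => dilate ψ j k (x - l) from hfin.hasSum
  refine summable_of_hasFiniteSupport ?_
  refine (Set.finite_Icc ⌊x - (S + k) / 2 ^ j⌋ ⌈x + (S + k) / 2 ^ j⌉).subset fun l hl => ?_
  have h1 : |2 ^ j * (x - l) - ((k : ℤ) : ℝ)| ≤ S := by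
    by_contra hcon
    exact hl (by
      show dilate ψ j k (x - l) = 0
      rw [dilate, hS _ (not_le.1 hcon), mul_zero])
  have h2 : (0 : ℝ) < 2 ^ j := by positivity
  have hk0 : (0 : ℝ) ≤ k := by positivity
  push_cast at h1
  rw [abs_le] at h1
  constructor
  · have : x - (S + k) / 2 ^ j ≤ l := by
      rw [sub_le_iff_le_add, ← sub_le_iff_le_add', le_div_iff₀ h2]; nlinarith
    exact_mod_cast (Int.floor_le _).trans this
  · have : (l : ℝ) ≤ x + (S + k) / 2 ^ j := by
      rw [← sub_le_iff_le_add', le_div_iff₀ h2]; nlinarith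
    exact_mod_cast this.trans (Int.le_ceil _)

theorem sum_abs_translates_le (hB : ∀ y, |ψ y| ≤ B) (hS : ∀ y, (S : ℝ) < |y| → ψ y = 0) (N : ℕ)
    (y : ℝ) : ∑ k ∈ Finset.range N, |ψ (y - ((k : ℤ) : ℝ))| ≤ (2 * S + 1) * B := by
  have hB0 : 0 ≤ B := (abs_nonneg _).trans (hB 0)
  set F := Finset.Icc ⌈y - S⌉ ⌊y + S⌋ with hF
  have hcard : (F.card : ℝ) ≤ 2 * S + 1 := by
    have h1 : ((⌊y + S⌋ + 1 - ⌈y - S⌉ : ℤ) : ℝ) ≤ ((2 * S + 1 : ℤ) : ℝ) := by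
      push_cast
      have := Int.floor_le (y + S)
      have := Int.le_ceil (y - S)
      linarith
    have h2 : (⌊y + S⌋ + 1 - ⌈y - S⌉).toNat ≤ 2 * S + 1 := by
      have := Int.cast_le.1 h1
      omega
    rw [hF, Int.card_Icc]
    exact_mod_cast h2
  have hout : ∀ k : ℤ, k ∉ F → |ψ (y - k)| = 0 := by
    intro k hk
    rw [abs_eq_zero]
    refine hS _ (not_le.1 fun hle => hk ?_)
    rw [abs_le] at hle
    rw [hF, Finset.mem_Icc, Int.ceil_le, Int.le_floor]
    constructor <;> linarith
  calc ∑ k ∈ Finset.range N, |ψ (y - ((k : ℤ) : ℝ))|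
      = ∑ k ∈ (Finset.range N).map Nat.castEmbedding, |ψ (y - ((k : ℤ) : ℝ))| := by
        rw [Finset.sum_map]; rfl
    _ ≤ ∑ k ∈ (Finset.range N).map Nat.castEmbedding ∪ F, |ψ (y - ((k : ℤ) : ℝ))| :=
        Finset.sum_le_sum_of_subset_of_nonneg Finset.subset_union_left fun _ _ _ => abs_nonneg _
    _ = ∑ k ∈ F, |ψ (y - ((k : ℤ) : ℝ))| :=
        (Finset.sum_subset Finset.subset_union_right fun k _ hk => hout k hk).symm
    _ ≤ ∑ _k ∈ F, B := Finset.sum_le_sum fun k _ => hB _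
    _ = F.card * B := by simp
    _ ≤ _ := by gcongr

theorem sum_abs_periodized_le (hB : ∀ y, |ψ y| ≤ B) (hS : ∀ y, (S : ℝ) < |y| → ψ y = 0) (j : ℕ)
    {x : ℝ} (hx : x ∈ Set.Icc (0 : ℝ) 1) :
    ∑ k ∈ Finset.range (2 ^ j), |periodized ψ j k x| ≤
      (2 * S + 3) * ((2 * S + 1) * B) * (2 : ℝ) ^ ((j : ℝ) / 2) := by
  have h2 : (0 : ℝ) < (2 : ℝ) ^ ((j : ℝ) / 2) := by positivity
  calc ∑ k ∈ Finset.range (2 ^ j), |periodized ψ j k x|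
      ≤ ∑ k ∈ Finset.range (2 ^ j), ∑ l ∈ Finset.Icc (-((S : ℤ) + 1)) ((S : ℤ) + 1),
          |dilate ψ j k (x - l)| := by
        refine Finset.sum_le_sum fun k hk => ?_
        rw [periodized_eq_sum hS (Finset.mem_range.1 hk) hx]
        exact Finset.abs_sum_le_sum_abs _ _
    _ = ∑ l ∈ Finset.Icc (-((S : ℤ) + 1)) ((S : ℤ) + 1), (2 : ℝ) ^ ((j : ℝ) / 2) *
          ∑ k ∈ Finset.range (2 ^ j), |ψ (2 ^ j * (x - l) - ((k : ℤ) : ℝ))| := by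
        rw [Finset.sum_comm]
        refine Finset.sum_congr rfl fun l _ => ?_
        rw [Finset.mul_sum]
        refine Finset.sum_congr rfl fun k _ => ?_
        rw [dilate, abs_mul, abs_of_pos h2]
    _ ≤ ∑ _l ∈ Finset.Icc (-((S : ℤ) + 1)) ((S : ℤ) + 1), (2 : ℝ) ^ ((j : ℝ) / 2) *
          ((2 * S + 1) * B) := by
        refine Finset.sum_le_sum fun l _ => ?_
        gcongr
        exact sum_abs_translates_le hB hS _ _
    _ = _ := by
        rw [Finset.sum_const, Int.card_Icc, nsmul_eq_mul]
        have : ((((S : ℤ) + 1 + 1 - -((S : ℤ) + 1)).toNat : ℕ) : ℝ) = 2 * S + 3 := by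
          have : ((S : ℤ) + 1 + 1 - -((S : ℤ) + 1)).toNat = 2 * S + 3 := by omega
          rw [this]; push_cast; ring
        rw [this]; ring

theorem integrable_of_bounded_of_support (hψ : Measurable ψ) (hB : ∀ y, |ψ y| ≤ B)
    (hS : ∀ y, (S : ℝ) < |y| → ψ y = 0) : Integrable ψ := by
  have h : Integrable ((Set.Icc (-(S : ℝ)) S).indicator fun _ => B) :=
    (integrable_indicator_iff measurableSet_Icc).2 (by simp [integrableOn_const_iff])
  refine h.mono' hψ.aestronglyMeasurable (Filter.Eventually.of_forall fun y => ?_)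
  by_cases hy : y ∈ Set.Icc (-(S : ℝ)) S
  · rw [Set.indicator_of_mem hy]; exact hB y
  · rw [Set.indicator_of_notMem hy, hS y (not_le.1 fun h => hy (abs_le.1 h))]; simp

/-- The factor `2^{-j/2}` compensates the `2^{j/2}` of `sum_abs_periodized_le`, making the product
of the two bounds free of `j`. -/
theorem integral_abs_periodized_le (hψ : Measurable ψ) (hB : ∀ y, |ψ y| ≤ B)
    (hS : ∀ y, (S : ℝ) < |y| → ψ y = 0) {j k : ℕ} (hk : k < 2 ^ j) :
    ∫ x in Set.Icc (0 : ℝ) 1, |periodized ψ j k x| ≤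
      (2 * S + 3) * (∫ y, |ψ y|) * ((2 : ℝ) ^ ((j : ℝ) / 2))⁻¹ := by
  have h2 : (0 : ℝ) < (2 : ℝ) ^ ((j : ℝ) / 2) := by positivity
  have hψi := integrable_of_bounded_of_support hψ hB hS
  have hdil : Integrable (dilate ψ j k) := by
    have := ((hψi.comp_sub_right ((k : ℤ) : ℝ)).comp_mul_left' (R := (2 : ℝ) ^ j)
      (by positivity)).const_mul ((2 : ℝ) ^ ((j : ℝ) / 2))
    exact this
  have hdint : ∫ x, |dilate ψ j k x| = (∫ y, |ψ y|) * ((2 : ℝ) ^ ((j : ℝ) / 2))⁻¹ := by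
    have e1 : ∀ x, |dilate ψ j k x| =
        (2 : ℝ) ^ ((j : ℝ) / 2) * |ψ (2 ^ j * x - ((k : ℤ) : ℝ))| := by
      intro x; rw [dilate, abs_mul, abs_of_pos h2]
    simp_rw [e1]
    rw [integral_const_mul, Measure.integral_comp_mul_left (fun y => |ψ (y - ((k : ℤ) : ℝ))|),
      integral_sub_right_eq_self (fun y => |ψ y|), smul_eq_mul, abs_inv,
      abs_of_pos (by positivity : (0 : ℝ) < 2 ^ j)]
    have e2 : (2 : ℝ) ^ j = (2 : ℝ) ^ ((j : ℝ) / 2) * (2 : ℝ) ^ ((j : ℝ) / 2) := by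
      rw [← Real.rpow_add two_pos, add_halves, Real.rpow_natCast]
    rw [e2]; field_simp
  have hI : ∀ l : ℤ, Integrable fun x : ℝ => |dilate ψ j k (x - l)| := fun l =>
    (hdil.comp_sub_right (l : ℝ)).abs
  calc ∫ x in Set.Icc (0 : ℝ) 1, |periodized ψ j k x|
      ≤ ∫ x in Set.Icc (0 : ℝ) 1, ∑ l ∈ Finset.Icc (-((S : ℤ) + 1)) ((S : ℤ) + 1),
          |dilate ψ j k (x - l)| := by
        refine integral_mono_of_nonneg (Filter.Eventually.of_forall fun x => abs_nonneg _)
          (integrable_finsetSum _ fun l _ => (hI l).integrableOn) ?_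
        filter_upwards [ae_restrict_mem measurableSet_Icc] with x hx
        rw [periodized_eq_sum hS hk hx]
        exact Finset.abs_sum_le_sum_abs _ _
    _ ≤ ∫ x, ∑ l ∈ Finset.Icc (-((S : ℤ) + 1)) ((S : ℤ) + 1), |dilate ψ j k (x - l)| :=
        setIntegral_le_integral (integrable_finsetSum _ fun l _ => hI l)
          (Filter.Eventually.of_forall fun x => Finset.sum_nonneg fun l _ => abs_nonneg _)
    _ = ∑ _l ∈ Finset.Icc (-((S : ℤ) + 1)) ((S : ℤ) + 1),
          (∫ y, |ψ y|) * ((2 : ℝ) ^ ((j : ℝ) / 2))⁻¹ := by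
        rw [integral_finsetSum _ fun l _ => hI l]
        refine Finset.sum_congr rfl fun l _ => ?_
        rw [integral_sub_right_eq_self (fun x => |dilate ψ j k x|), hdint]
    _ = _ := by
        rw [Finset.sum_const, Int.card_Icc, nsmul_eq_mul]
        have : ((((S : ℤ) + 1 + 1 - -((S : ℤ) + 1)).toNat : ℕ) : ℝ) = 2 * S + 3 := by
          have : ((S : ℤ) + 1 + 1 - -((S : ℤ) + 1)).toNat = 2 * S + 3 := by omega
          rw [this]; push_cast; ring
        rw [this]; ring

end Wavelet

/-- Schur test: Cauchy–Schwarz gives `(∑ t_k h_k)² ≤ (∑ |h_k|) (∑ t_k² |h_k|)` pointwise, to be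
integrated. -/
theorem integral_sum_mul_sq_le {ι : Type*} [Fintype ι] {μ : Measure ℝ} [IsFiniteMeasure μ]
    {h : ι → ℝ → ℝ} {R A : ℝ} (hh : ∀ k, Measurable (h k)) (hR0 : 0 ≤ R)
    (hR : ∀ᵐ x ∂μ, ∑ k, |h k x| ≤ R) (hA : ∀ k, ∫ x, |h k x| ∂μ ≤ A) (t : ι → ℝ) :
    ∫ x, (∑ k, t k * h k x) ^ 2 ∂μ ≤ R * A * ∑ k, t k ^ 2 := by
  have hI : ∀ k, Integrable (fun x => |h k x|) μ := fun k =>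
    Integrable.of_bound (hh k).abs.aestronglyMeasurable R (by
      filter_upwards [hR] with x hx
      rw [Real.norm_eq_abs, abs_abs]
      exact (Finset.single_le_sum (f := fun k => |h k x|) (fun k _ => abs_nonneg _)
        (Finset.mem_univ k)).trans hx)
  calc ∫ x, (∑ k, t k * h k x) ^ 2 ∂μ ≤ ∫ x, R * ∑ k, t k ^ 2 * |h k x| ∂μ := by
        refine integral_mono_of_nonneg (Filter.Eventually.of_forall fun x => sq_nonneg _)
          ((integrable_finsetSum _ fun k _ => (hI k).const_mul _).const_mul _) ?_
        filter_upwards [hR] with x hx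
        have h1 := Finset.sum_sq_le_sum_mul_sum_of_sq_le_mul Finset.univ
          (r := fun k => t k * h k x) (f := fun k => |h k x|) (g := fun k => t k ^ 2 * |h k x|)
          (fun k _ => abs_nonneg _) (fun k _ => by positivity)
          (fun k _ => le_of_eq (by rw [mul_pow, ← sq_abs (h k x)]; ring))
        refine h1.trans (mul_le_mul_of_nonneg_right hx (Finset.sum_nonneg fun k _ => by positivity))
    _ = R * ∑ k, t k ^ 2 * ∫ x, |h k x| ∂μ := by
        rw [integral_const_mul, integral_finsetSum _ fun k _ => (hI k).const_mul _]
        simp_rw [integral_const_mul]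
    _ ≤ R * ∑ k, t k ^ 2 * A := by gcongr with k; exact hA k
    _ = _ := by rw [← Finset.sum_mul]; ring

/-! ### Joint sub-Gaussianity at one resolution level -/

theorem IsWaveletPair.exists_support_bound {φ ψ : ℝ → ℝ} (hw : IsWaveletPair φ ψ) :
    ∃ S : ℕ, ∀ y, (S : ℝ) < |y| → ψ y = 0 := by
  obtain ⟨r, hr⟩ := hw.hasCompactSupport_mother.isBounded.subset_closedBall 0
  refine ⟨⌈r⌉₊, fun y hy => ?_⟩
  by_contra hne
  have := hr (subset_tsupport ψ hne)
  rw [mem_closedBall_zero_iff, Real.norm_eq_abs] at this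
  linarith [Nat.le_ceil r]

theorem IsRandomDesignSample.measurable_empiricalCoeff {Ω : Type*} [MeasurableSpace Ω]
    {P : Measure Ω} {f g : ℝ → ℝ} {n : ℕ} {X Y z : Fin n → Ω → ℝ}
    (hs : IsRandomDesignSample P f g X Y z) (hf : Measurable f) (hg : Measurable g) {ψ : ℝ → ℝ}
    {j k : ℕ} (hψ : Measurable (periodized ψ j k)) :
    Measurable fun ω => empiricalCoeff ψ g (fun i => X i ω) (fun i => Y i ω) j k := by
  have hX := hs.measurable_design
  have hY : ∀ i, Measurable (Y i) := fun i => by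
    have : Y i = fun ω => f (X i ω) + z i ω := funext (hs.regression i)
    rw [this]
    exact (hf.comp (hX i)).add (hs.measurable_noise i)
  unfold empiricalCoeff
  refine (Finset.measurable_sum _ fun i _ => ?_).const_mul _
  exact ((hY i).mul (hg.comp (hX i)).inv).mul (hψ.comp (hX i))

theorem card_block_le_blockLength (p : ℝ) (n j K : ℕ) :
    (block p n j K).card ≤ blockLength p n := by
  have h : block p n j K ⊆ Finset.Ico ((K - 1) * blockLength p n) (K * blockLength p n) := by
    intro k hk
    rw [Finset.mem_Ico]
    exact (Finset.mem_filter.1 hk).2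
  refine (Finset.card_le_card h).trans ?_
  rw [Nat.card_Ico, ← Nat.sub_mul]
  calc _ ≤ 1 * blockLength p n := Nat.mul_le_mul_right _ (by omega)
    _ = _ := one_mul _

theorem two_pow_le_sqrt_of_le_finestLevel {n j : ℕ} (hn : 1 ≤ Real.log n) (hj : j ≤ finestLevel n) :
    (2 : ℝ) ^ j ≤ √n := by
  have hn0 : (0 : ℝ) < n := by
    rcases Nat.eq_zero_or_pos n with h | h
    · subst h; norm_num at hn
    · exact_mod_cast h
  have hnl : (0 : ℝ) < n / Real.log n := by positivity
  have h1 : (n : ℝ) / Real.log n ≤ n := div_le_self hn0.le hn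
  rcases Nat.eq_zero_or_pos j with h0 | h0
  · subst h0
    have := Real.log_le_self hn0.le
    rw [pow_zero, Real.one_le_sqrt]; linarith
  · have h2 : (j : ℝ) ≤ 1 / 2 * Real.logb 2 (n / Real.log n) := by
      unfold finestLevel at hj
      exact (Nat.le_floor_iff' h0.ne').1 hj
    calc (2 : ℝ) ^ j = (2 : ℝ) ^ (j : ℝ) := (Real.rpow_natCast _ _).symm
      _ ≤ (2 : ℝ) ^ (1 / 2 * Real.logb 2 (n / Real.log n)) :=
        Real.rpow_le_rpow_of_exponent_le one_le_two h2
      _ = (n / Real.log n) ^ (1 / 2 : ℝ) := by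
        rw [mul_comm, Real.rpow_mul two_pos.le, Real.rpow_logb two_pos (by norm_num) hnl]
      _ ≤ (n : ℝ) ^ (1 / 2 : ℝ) := by gcongr
      _ = √n := (Real.sqrt_eq_rpow _).symm

/-- Joint sub-Gaussianity of the normalised errors of the empirical wavelet coefficients at one
level, on a cube whose radius grows like `n ^ (1 / 4)`. -/
theorem IsWaveletPair.exists_subGaussianOn {φ ψ : ℝ → ℝ} (hw : IsWaveletPair φ ψ) {M c : ℝ}
    (hM : 0 < M) (hc : 0 < c) :
    ∃ C τ : ℝ, 0 < C ∧ 0 < τ ∧ ∀ n : ℕ, 1 ≤ Real.log n →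
      ∀ f : ℝ → ℝ, Measurable f →
      (∀ᵐ x ∂(volume.restrict (Set.Icc (0 : ℝ) 1)), |f x| ≤ M) →
      ∀ g : ℝ → ℝ, Measurable g →
      (∀ᵐ x ∂(volume.restrict (Set.Icc (0 : ℝ) 1)), c ≤ g x) →
      ∀ (Ω : Type*) [MeasurableSpace Ω] (P : Measure Ω) [IsProbabilityMeasure P]
        (X Y z : Fin n → Ω → ℝ), IsRandomDesignSample P f g X Y z →
      ∀ j : ℕ, j ≤ finestLevel n → ∀ s ⊆ Finset.range (2 ^ j),
        SubGaussianOn P (fun (k : s) ω => √n *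
          (empiricalCoeff ψ g (fun i => X i ω) (fun i => Y i ω) j k - waveletCoeff ψ f j k))
          C (τ * √(√n)) := by
  obtain ⟨S, hS⟩ := hw.exists_support_bound
  obtain ⟨B₀, hB₀⟩ := hw.bounded_mother
  have hψ := hw.measurable_mother
  set B := max B₀ 1 with hBdef
  have hB : ∀ y, |ψ y| ≤ B := fun y => (hB₀ y).trans (le_max_left _ _)
  have hB0 : 0 < B := zero_lt_one.trans_le (le_max_right _ _)
  set R := (2 * (S : ℝ) + 3) * ((2 * S + 1) * B) with hRdef
  have hR0 : 0 < R := by positivity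
  set A := (2 * (S : ℝ) + 3) * ∫ y, |ψ y| with hA
  have hA0 : 0 ≤ A := mul_nonneg (by positivity) (integral_nonneg fun y => abs_nonneg _)
  -- The `+ 1` forces positivity without a lower bound on `A`. The radius constant turns `T R
  -- 2^{j/2} ≤ c √n / (2(M+1))` into `2^{j/2} ≤ n^{1/4}`.
  refine ⟨(1 + 2 * M ^ 2) * ((R * A + 1) / c), c / (2 * (M + 1) * R), by positivity, by positivity,
    ?_⟩
  intro n hn f hf hfM g hg hgc Ω _ P _ X Y z hs j hj s hsub
  have hn0 : 0 < n := by
    rcases Nat.eq_zero_or_pos n with h | h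
    · subst h; norm_num at hn
    · exact h
  have h2 : (0 : ℝ) < (2 : ℝ) ^ ((j : ℝ) / 2) := by positivity
  have hRs : ∀ x ∈ Set.Icc (0 : ℝ) 1, ∑ k : s, |periodized ψ j k x| ≤
      R * (2 : ℝ) ^ ((j : ℝ) / 2) := fun x hx => by
    rw [Finset.sum_coe_sort s fun k => |periodized ψ j k x|]
    exact (Finset.sum_le_sum_of_subset_of_nonneg hsub fun _ _ _ => abs_nonneg _).trans
      (sum_abs_periodized_le hB hS j hx)
  have hpm : ∀ k : s, Measurable (periodized ψ j k) := fun k => measurable_periodized hψ hS j k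
  refine hs.subGaussianOn hn0 hM.le hc hf hfM hg hgc hpm hRs (fun t => ?_) (by positivity) ?_
  · refine (integral_sum_mul_sq_le (R := R * (2 : ℝ) ^ ((j : ℝ) / 2)) hpm (by positivity) ?_
      (fun k => integral_abs_periodized_le hψ hB hS (Finset.mem_range.1 (hsub k.2))) t).trans ?_
    · filter_upwards [ae_restrict_mem measurableSet_Icc] with x hx using hRs x hx
    · refine mul_le_mul_of_nonneg_right ?_ (Finset.sum_nonneg fun k _ => sq_nonneg _)
      rw [← hA]
      calc _ = R * A := by field_simp
        _ ≤ _ := by linarith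
  · have h3 : (2 : ℝ) ^ ((j : ℝ) / 2) ≤ √(√n) := by
      have : (2 : ℝ) ^ ((j : ℝ) / 2) = √((2 : ℝ) ^ j) := by
        rw [Real.sqrt_eq_rpow, ← Real.rpow_natCast, ← Real.rpow_mul two_pos.le]
        congr 1; ring
      rw [this]
      exact Real.sqrt_le_sqrt (two_pow_le_sqrt_of_le_finestLevel hn hj)
    calc c / (2 * (M + 1) * R) * √(√n) * (R * (2 : ℝ) ^ ((j : ℝ) / 2))
        ≤ c / (2 * (M + 1) * R) * √(√n) * (R * √(√n)) := by gcongr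
      _ = c / (2 * (M + 1)) * (√(√n) * √(√n)) := by field_simp
      _ = c * √n / (2 * (M + 1)) := by
        rw [Real.mul_self_sqrt (Real.sqrt_nonneg _)]; ring

/-! ### Choice of parameters and the block tail -/

/-- For large `n` the cube must contain the parameters `±1` (moments) and those up to `M / (2C)`
(truncation at `M ≍ √(log n)`); this fixes `N`. -/
theorem eventually_sqrt_log_le {a τ : ℝ} (ha : 0 < a) (hτ : 0 < τ) :
    ∀ᶠ n : ℕ in Filter.atTop,
      1 ≤ Real.log n ∧ 1 ≤ τ * √(√n) ∧ a * √(Real.log n) ≤ τ * √(√n) := by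
  have hcast := tendsto_natCast_atTop_atTop (R := ℝ)
  have h1 : ∀ᶠ n : ℕ in Filter.atTop, 1 ≤ Real.log n :=
    (Real.tendsto_log_atTop.comp hcast).eventually_ge_atTop 1
  have h2 : ∀ᶠ n : ℕ in Filter.atTop, τ⁻¹ ≤ √(√n) :=
    (Real.tendsto_sqrt_atTop.comp (Real.tendsto_sqrt_atTop.comp hcast)).eventually_ge_atTop _
  have h3 : ∀ᶠ n : ℕ in Filter.atTop, ‖Real.log n‖ ≤ (τ / a) ^ 2 * ‖(n : ℝ) ^ (1 / 2 : ℝ)‖ :=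
    hcast.eventually ((isLittleO_log_rpow_atTop (by norm_num : (0 : ℝ) < 1 / 2)).def
      (by positivity : 0 < (τ / a) ^ 2))
  filter_upwards [h1, h2, h3] with n e1 e2 e3
  refine ⟨e1, ?_, ?_⟩
  · rwa [inv_le_iff_one_le_mul₀' hτ] at e2
  · rw [← Real.sqrt_eq_rpow, Real.norm_eq_abs, Real.norm_eq_abs, abs_of_nonneg (by linarith),
      abs_of_nonneg (Real.sqrt_nonneg _)] at e3
    have : √(Real.log n) ≤ τ / a * √(√n) := by
      rw [← Real.sqrt_sq (by positivity : 0 ≤ τ / a), ← Real.sqrt_mul (sq_nonneg _)]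
      exact Real.sqrt_le_sqrt e3
    calc a * √(Real.log n) ≤ a * (τ / a * √(√n)) := by gcongr
      _ = _ := by field_simp

theorem half_rpow_log_le_blockLength {p : ℝ} (hp : 0 ≤ p) {n : ℕ} (hn : 1 ≤ Real.log n) :
    Real.log n ^ (p / 2) / 2 ≤ blockLength p n := by
  have h1 : 1 ≤ Real.log n ^ (p / 2) := Real.one_le_rpow hn (by linarith)
  have h2 : Real.log n ^ (p / 2) < blockLength p n + 1 := Nat.lt_floor_add_one _
  have h3 : (1 : ℝ) ≤ blockLength p n := by
    exact_mod_cast Nat.le_floor (by exact_mod_cast h1)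
  linarith

/-- Numerical part of the block deviation inequality: the tail bound at truncation level
`√(4 C (p + 1) log n)` is at most `3 n ^ (-p)`. -/
theorem block_tail_bound_le {p C Q D x m L : ℝ} {n : ℕ} (hp : 2 ≤ p) (hC : 0 < C) (hQ : 0 < Q)
    (hn : 1 ≤ Real.log n) (hD : D = 32 * p * C * √(4 * C * (p + 1)) ^ (p - 2))
    (hx : x = L * (Q + D)) (hmn : m ≤ n) (hmL : m ≤ L)
    (hL : Real.log n ^ (p / 2) / 2 ≤ L) :
    m * (2 * Real.exp (-((√(4 * C * (p + 1)) * √(Real.log n)) ^ 2 / (4 * C)))) +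
      Real.exp (1 / (16 * C) * (√(4 * C * (p + 1)) * √(Real.log n)) ^ (2 - p) * (Q * m - x)) ≤
      4 * (n : ℝ) ^ (-p) := by
  set ℓ := Real.log n with hℓ
  have hℓ0 : 0 < ℓ := by linarith
  set A := √(4 * C * (p + 1)) with hA
  have hA0 : 0 < A := Real.sqrt_pos.2 (by positivity)
  have hn0 : (0 : ℝ) < n := by
    rcases Nat.eq_zero_or_pos n with h | h
    · subst h; norm_num [hℓ] at hn
    · exact_mod_cast h
  have hD0 : 0 < D := by rw [hD]; positivity
  have hnp : Real.exp (-(p * ℓ)) = (n : ℝ) ^ (-p) := by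
    rw [Real.rpow_def_of_pos hn0]; congr 1; ring
  -- Exponent `p + 1` rather than `p`: the spare `n⁻¹` pays for a union bound over at most `n`
  -- coordinates.
  have h1 : (A * √ℓ) ^ 2 / (4 * C) = (p + 1) * ℓ := by
    rw [mul_pow, hA, Real.sq_sqrt (by positivity), Real.sq_sqrt hℓ0.le]; field_simp
  have h2 : (n : ℝ) * Real.exp (-((p + 1) * ℓ)) = (n : ℝ) ^ (-p) := by
    rw [← hnp]
    nth_rewrite 1 [← Real.exp_log hn0]
    rw [← Real.exp_add]; congr 1; rw [← hℓ]; ring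
  have h3 : (A * √ℓ) ^ (2 - p) = A ^ (2 - p) * ℓ ^ (1 - p / 2) := by
    rw [Real.mul_rpow hA0.le (Real.sqrt_nonneg _), Real.sqrt_eq_rpow, ← Real.rpow_mul hℓ0.le]
    congr 2; ring
  have hAA : A ^ (2 - p) * A ^ (p - 2) = 1 := by rw [← Real.rpow_add hA0]; simp
  have hℓℓ : ℓ ^ (1 - p / 2) * ℓ ^ (p / 2) = ℓ := by rw [← Real.rpow_add hℓ0]; simp
  -- As `m ≤ L`, the `Q` part of `x` absorbs `Q m`. The constant `D` is calibrated so that the rest,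
  -- with `L ≥ ℓ^{p/2} / 2`, gives at least `p ℓ`.
  have h4 : 1 / (16 * C) * (A * √ℓ) ^ (2 - p) * (Q * m - x) ≤ -(p * ℓ) := by
    have e1 : Q * m - x ≤ -(ℓ ^ (p / 2) / 2 * D) := by rw [hx]; nlinarith
    calc _ ≤ 1 / (16 * C) * (A * √ℓ) ^ (2 - p) * (-(ℓ ^ (p / 2) / 2 * D)) := by gcongr
      _ = -(p * (A ^ (2 - p) * A ^ (p - 2)) * (ℓ ^ (1 - p / 2) * ℓ ^ (p / 2))) := by
        rw [h3, hD]; field_simp; norm_num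
      _ = _ := by rw [hAA, hℓℓ, mul_one]
  have h5 : 0 < (n : ℝ) ^ (-p) := by positivity
  rw [h1]
  calc _ ≤ (n : ℝ) * (2 * Real.exp (-((p + 1) * ℓ))) + Real.exp (-(p * ℓ)) := by gcongr
    _ = 3 * (n : ℝ) ^ (-p) := by rw [hnp, ← h2]; ring
    _ ≤ _ := by linarith

end WaveletRegression

/-! ### The proposition -/

theorem proposition4p1 (φ ψ : ℝ → ℝ) (hw : WaveletRegression.IsWaveletPair φ ψ)
    (p : ℝ) (hp : 2 ≤ p) (M' : ℝ) (hM' : 0 < M') (c G : ℝ) (hc : 0 < c) :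
    ∃ μ₁ C : ℝ, 0 < μ₁ ∧ 0 < C ∧ ∃ N : ℕ, ∀ n : ℕ, N ≤ n →
      ∀ f : ℝ → ℝ, Measurable f →
      (∀ᵐ x ∂(volume.restrict (Set.Icc (0 : ℝ) 1)), |f x| ≤ M') →
      ∀ g : ℝ → ℝ, Measurable g →
      (∀ᵐ x ∂(volume.restrict (Set.Icc (0 : ℝ) 1)), c ≤ g x ∧ g x ≤ G) →
      ∀ (Ω : Type*) [MeasurableSpace Ω] (P : Measure Ω) [IsProbabilityMeasure P]
        (X Y z : Fin n → Ω → ℝ), WaveletRegression.IsRandomDesignSample P f g X Y z →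
      ∀ j : ℕ, WaveletRegression.coarsestLevel p n ≤ j → j ≤ WaveletRegression.finestLevel n →
        (∀ k ∈ Finset.range (2 ^ j),
          Integrable (fun ω =>
            |WaveletRegression.empiricalCoeff ψ g (fun i => X i ω) (fun i => Y i ω) j k
              - WaveletRegression.waveletCoeff ψ f j k| ^ (2 * p)) P ∧
          ∫ ω, |WaveletRegression.empiricalCoeff ψ g (fun i => X i ω) (fun i => Y i ω) j k
              - WaveletRegression.waveletCoeff ψ f j k| ^ (2 * p) ∂P ≤ C * (n : ℝ) ^ (-p)) ∧
        (∀ K ∈ WaveletRegression.blockIndices p n j,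
          P.real {ω | μ₁ * 2⁻¹ * (n : ℝ) ^ (-(1 / 2) : ℝ) ≤
            ((WaveletRegression.blockLength p n : ℝ)⁻¹ *
              ∑ k ∈ WaveletRegression.block p n j K,
                |WaveletRegression.empiricalCoeff ψ g (fun i => X i ω) (fun i => Y i ω) j k
                  - WaveletRegression.waveletCoeff ψ f j k| ^ p) ^ (1 / p)}
            ≤ 4 * (n : ℝ) ^ (-p)) := by
  open WaveletRegression in
  obtain ⟨C, τ, hC, hτ, hsub⟩ := hw.exists_subGaussianOn hM' hc
  obtain ⟨Q, hQ0, hQ⟩ := exists_bound_sum_rpow_mul_exp p (s := 1 / (8 * C)) (by positivity)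
  obtain ⟨K₀, hK₀, hK₀p⟩ := exists_rpow_abs_le_exp (2 * p) (by linarith)
  have hp0 : 0 < p := by linarith
  set A := √(4 * C * (p + 1)) with hA
  have hA0 : 0 < A := Real.sqrt_pos.2 (by positivity)
  set D := 32 * p * C * A ^ (p - 2) with hD
  have hD0 : 0 < D := by positivity
  obtain ⟨N, hN⟩ := Filter.eventually_atTop.1
    (eventually_sqrt_log_le (a := A / (2 * C)) (by positivity) hτ)
  -- The factor `2` cancels the `2⁻¹` of the threshold, so the event becomes `L (Q + D) ≤ ∑ |W k| ^
  -- p` after taking `p`-th powers.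
  refine ⟨2 * (Q + D) ^ (1 / p), K₀ * (2 * Real.exp C), by positivity, by positivity, N, ?_⟩
  intro n hn f hf hfM g hg hgc Ω _ P _ X Y z hs j _ hj
  obtain ⟨hlog, hT1, hTM⟩ := hN n hn
  have hn0 : (0 : ℝ) < n := by
    rcases Nat.eq_zero_or_pos n with h | h
    · subst h; norm_num at hlog
    · exact_mod_cast h
  have hsn : 0 < √(n : ℝ) := Real.sqrt_pos.2 hn0
  obtain ⟨S, hS⟩ := hw.exists_support_bound
  have hmeas : ∀ k, Measurable fun ω => √n *
      (empiricalCoeff ψ g (fun i => X i ω) (fun i => Y i ω) j k - waveletCoeff ψ f j k) := fun k =>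
    ((hs.measurable_empiricalCoeff hf hg
      (measurable_periodized hw.measurable_mother hS j k)).sub_const _).const_mul _
  have hSG := hsub n hlog f hf hfM g hg (hgc.mono fun x hx => hx.1) Ω P X Y z hs j hj
  constructor
  · intro k hk
    have h1 := (hSG _ subset_rfl).integrable_and_integral_rpow_le (fun k => hmeas k) hT1 hK₀ hK₀p
      ⟨k, hk⟩
    have e : ∀ ω, |empiricalCoeff ψ g (fun i => X i ω) (fun i => Y i ω) j k -
        waveletCoeff ψ f j k| ^ (2 * p) = (n : ℝ) ^ (-p) * |√n *
          (empiricalCoeff ψ g (fun i => X i ω) (fun i => Y i ω) j k -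
            waveletCoeff ψ f j k)| ^ (2 * p) := by
      intro ω
      have e1 : √(n : ℝ) ^ (2 * p) = (n : ℝ) ^ p := by
        rw [Real.sqrt_eq_rpow, ← Real.rpow_mul hn0.le]; congr 1; ring
      rw [abs_mul, abs_of_pos hsn, Real.mul_rpow hsn.le (abs_nonneg _), e1, ← mul_assoc,
        ← Real.rpow_add hn0]
      simp
    simp_rw [e]
    refine ⟨h1.1.const_mul _, ?_⟩
    rw [integral_const_mul, mul_comm]
    exact mul_le_mul_of_nonneg_right h1.2 (by positivity)
  · intro K _
    set s := block p n j K with hsdef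
    have hsr : s ⊆ Finset.range (2 ^ j) := Finset.filter_subset _ _
    have hL := half_rpow_log_le_blockLength hp0.le hlog
    have hL0 : (0 : ℝ) < blockLength p n := lt_of_lt_of_le (by positivity) hL
    have hcardn : (Fintype.card s : ℝ) ≤ n := by
      have h1 : (s.card : ℝ) ≤ 2 ^ j := by
        have := Finset.card_le_card hsr
        rw [Finset.card_range] at this
        exact_mod_cast this
      have h2 : √(n : ℝ) ≤ n := by
        rw [Real.sqrt_le_left hn0.le]
        have : (1 : ℝ) ≤ n := by have := Real.log_le_self hn0.le; linarith
        nlinarith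
      rw [Fintype.card_coe]
      linarith [two_pow_le_sqrt_of_le_finestLevel hlog hj]
    have hcardL : (Fintype.card s : ℝ) ≤ blockLength p n := by
      rw [Fintype.card_coe]
      exact_mod_cast card_block_le_blockLength p n j K
    have htail := (hSG s hsr).measure_sum_rpow_ge_le (fun k => hmeas k) hp
      (M := A * √(Real.log n)) (mul_pos hA0 (Real.sqrt_pos.2 (by linarith))) hC
      ((le_of_eq (by ring)).trans hTM) hQ (blockLength p n * (Q + D))
    have hnum := block_tail_bound_le hp hC hQ0 hlog hD rfl hcardn hcardL hL
    refine ENNReal.toReal_le_of_le_ofReal (by positivity) ((measure_mono ?_).trans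
      (htail.trans (ENNReal.ofReal_le_ofReal hnum)))
    intro ω hω
    set F : ℝ := ∑ k ∈ s, |empiricalCoeff ψ g (fun i => X i ω) (fun i => Y i ω) j k -
      waveletCoeff ψ f j k| ^ p with hF
    have hF0 : 0 ≤ F := Finset.sum_nonneg fun k _ => by positivity
    have hω' : (Q + D) ^ (1 / p) * (√(n : ℝ))⁻¹ ≤ ((blockLength p n : ℝ)⁻¹ * F) ^ (1 / p) := by
      have e1 : (n : ℝ) ^ (-(1 / 2) : ℝ) = (√(n : ℝ))⁻¹ := by
        rw [Real.rpow_neg hn0.le, Real.sqrt_eq_rpow]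
      have h1 : 2 * (Q + D) ^ (1 / p) * 2⁻¹ * (n : ℝ) ^ (-(1 / 2) : ℝ) ≤
        ((blockLength p n : ℝ)⁻¹ * F) ^ (1 / p) := hω
      rw [e1] at h1
      linarith
    have h2 := Real.rpow_le_rpow (by positivity) hω' hp0.le
    rw [Real.mul_rpow (by positivity) (by positivity), ← Real.rpow_mul (by positivity),
      ← Real.rpow_mul (by positivity), one_div_mul_cancel hp0.ne', Real.rpow_one, Real.rpow_one,
      Real.inv_rpow hsn.le, ← div_eq_mul_inv, div_le_iff₀ (by positivity), inv_mul_eq_div,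
      div_mul_eq_mul_div, le_div_iff₀ hL0] at h2
    show _ ≤ ∑ k : s, |√n * (empiricalCoeff ψ g (fun i => X i ω) (fun i => Y i ω) j k -
      waveletCoeff ψ f j k)| ^ p
    rw [Finset.sum_coe_sort s fun k => |√n * (empiricalCoeff ψ g (fun i => X i ω)
      (fun i => Y i ω) j k - waveletCoeff ψ f j k)| ^ p]
    have h3 : ∑ k ∈ s, |√n * (empiricalCoeff ψ g (fun i => X i ω) (fun i => Y i ω) j k -
        waveletCoeff ψ f j k)| ^ p = F * √n ^ p := by
      rw [hF, Finset.sum_mul]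
      refine Finset.sum_congr rfl fun k _ => ?_
      rw [abs_mul, abs_of_pos hsn, Real.mul_rpow hsn.le (abs_nonneg _), mul_comm]
    rw [h3]
    linarith
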